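/- All graphs are finite, simple and undirected. A path $v_1,\dots,v_k$ of a graph $G$ (its vertices are pairwise distinct) is a *triangle path* if $G$ has no edge $v_iv_j$ with $|i-j|>2$. A set $S\subseteq V(G)$ is *$t$-convex* in $G$ if every triangle path of $G$ joining two vertices of $S$ has all its vertices in $S$; the *$t$-convexity number* of $G$ is the maximum cardinality of a $t$-convex set $S\neq V(G)$. A set $S\subseteq V(G)$ is a *separator* of $G$ if there are $a,b\in V(G)\setminus S$ such that every path of $G$ from $a$ to $b$ contains a vertex of $S$. A graph is *prime* if no clique (the empty set being a clique) is a separator of it. An *mp-subgraph* of $G$ is an inclusion-maximal prime induced subgraph of $G$. For an mp-subgraph $F$ of $G$ and a $t$-convex set $C\neq V(F)$ of the graph $F$, let $F(C)$ be the union of $C$ with the vertex sets of those connected components of $G-C$ that contain no vertex of $V(F)\setminus C$. Let $$c(G)=\max\{\,|F(C)| : F \text{ an mp-subgraph of } G,\ C\neq V(F) \text{ a } t\text{-convex set of } F\,\}.$$ **Theorem.** For every connected graph $G$, both maxima exist and the $t$-convexity number of $G$ is equal to $c(G)$. Moreover, the $t$-convexity number of a connected graph with $n$ vertices and $m$ edges,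 given by $n$, $m$ and a list of its edges, can be computed in $O(nm^2)$ time: there are a program for the unit-cost random access machine (with addition and truncated subtraction of natural numbers as its arithmetic) and a constant $K$ such that, for every such input, the program halts after at most $K(nm^2+1)$ steps and outputs the $t$-convexity number of the graph. -/

import Mathlib

namespace TrianglePath

/-! ### Triangle paths and the triangle path convexity -/

/-- A walk `v₀, v₁, …, v_k` is a triangle path if its vertices are pairwise distinct and no edge
of the graph joins `v_i` and `v_j` when `|j - i| > 2`. -/
def IsTrianglePath {V : Type*} (G : SimpleGraph V) {u v : V} (p : G.Walk u v) : Prop :=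
  p.IsPath ∧ ∀ i j : ℕ, j ≤ p.length → i + 2 < j → ¬ G.Adj (p.getVert i) (p.getVert j)

/-- `S` is `t`-convex: every triangle path joining two vertices of `S` stays in `S`. -/
def TConvex {V : Type*} (G : SimpleGraph V) (S : Set V) : Prop :=
  ∀ u ∈ S, ∀ v ∈ S, ∀ p : G.Walk u v, IsTrianglePath G p → ∀ w ∈ p.support, w ∈ S

/-- The cardinalities of the proper `t`-convex sets. -/
def properTConvexSizes {V : Type*} (G : SimpleGraph V) : Set ℕ :=
  {k | ∃ S : Set V, TConvex G S ∧ S ≠ Set.univ ∧ S.ncard = k}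

/-- The `t`-convexity number: the maximum cardinality of a proper `t`-convex set. -/
noncomputable def tConvexityNumber {V : Type*} (G : SimpleGraph V) : ℕ :=
  sSup (properTConvexSizes G)

/-! ### Maximal prime subgraphs -/

/-- `S` is a separator: two vertices outside `S` have all their connecting paths meet `S`. -/
def IsSeparator {V : Type*} (G : SimpleGraph V) (S : Set V) : Prop :=
  ∃ a ∉ S, ∃ b ∉ S, ∀ p : G.Walk a b, p.IsPath → ∃ w ∈ p.support, w ∈ S

/-- A graph is prime if it has no clique separator. The empty set counts as a clique, so a prime
graph has no two vertices in different components. -/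
def IsPrimeGraph {V : Type*} (G : SimpleGraph V) : Prop :=
  ∀ S : Set V, G.IsClique S → ¬ IsSeparator G S

/-- `U` is the vertex set of an `mp`-subgraph: an inclusion-maximal set inducing a prime graph. -/
def IsMPSubgraph {V : Type*} (G : SimpleGraph V) (U : Set V) : Prop :=
  Maximal (fun W : Set V => IsPrimeGraph (G.induce W)) U

/-- For `F = G[U]` and `C ⊆ U`, the set `F(C)`: the set `C` together with the vertices of those
connected components of `G - C` that avoid `U \ C`. -/
def extend {V : Type*} (G : SimpleGraph V) (U C : Set V) : Set V :=
  C ∪ {v | ∃ K : (G.induce Cᶜ).ConnectedComponent,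
      v ∈ Subtype.val '' K.supp ∧ Disjoint (Subtype.val '' K.supp) (U \ C)}

/-- The cardinalities `|F(C)|`, for `F = G[U]` an `mp`-subgraph of `G` and `C` a `t`-convex set
of `F` other than `V(F)`. -/
def extendSizes {V : Type*} (G : SimpleGraph V) : Set ℕ :=
  {k | ∃ U : Set V, IsMPSubgraph G U ∧ ∃ C : Set U, TConvex (G.induce U) C ∧ C ≠ Set.univ ∧
      (extend G U (Subtype.val '' C)).ncard = k}

/-- The number `c(G)`: the maximum of `|F(C)|`. -/
noncomputable def cNumber {V : Type*} (G : SimpleGraph V) : ℕ :=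
  sSup (extendSizes G)

/-! ### A random access machine with unit cost

The machine has registers and a memory, both indexed by `ℕ` and holding natural numbers. A program
is a finite structured command; it can mention only the finitely many registers written in it, and
reaches the memory by indirect addressing. The arithmetic is addition and truncated subtraction. -/

/-- A configuration of the machine. -/
structure Config where
  reg : ℕ → ℕ
  mem : ℕ → ℕ

/-- Programs. Numbers `a b c` are names of registers. -/
inductive Prog where
  /-- do nothing -/
  | skip : Prog
  /-- `a := k` -/
  | const (a k : ℕ) : Prog
  /-- `a := b` -/
  | copy (a b : ℕ) : Prog
  /-- `a := b + c` -/
  | add (a b c : ℕ) : Prog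
  /-- `a := b - c` (truncated) -/
  | sub (a b c : ℕ) : Prog
  /-- `a := mem[b]` -/
  | load (a b : ℕ) : Prog
  /-- `mem[a] := b` -/
  | store (a b : ℕ) : Prog
  /-- first `p`, then `q` -/
  | seq (p q : Prog) : Prog
  /-- if `a ≠ 0` then `p` else `q` -/
  | ite (a : ℕ) (p q : Prog) : Prog
  /-- while `a ≠ 0` do `p` -/
  | loop (a : ℕ) (p : Prog) : Prog

/-- The configuration after writing `x` into register `a`. -/
def Config.setReg (s : Config) (a x : ℕ) : Config :=
  { s with reg := Function.update s.reg a x }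

/-- The configuration after writing `x` into memory cell `i`. -/
def Config.setMem (s : Config) (i x : ℕ) : Config :=
  { s with mem := Function.update s.mem i x }

/-- `Runs p s s' t`: program `p`, started in configuration `s`, halts in configuration `s'` after
exactly `t` steps. Every elementary instruction and every test of a register costs one step. -/
inductive Runs : Prog → Config → Config → ℕ → Prop where
  | skip (s : Config) : Runs .skip s s 1
  | const (s : Config) (a k : ℕ) : Runs (.const a k) s (s.setReg a k) 1
  | copy (s : Config) (a b : ℕ) : Runs (.copy a b) s (s.setReg a (s.reg b)) 1
  | add (s : Config) (a b c : ℕ) : Runs (.add a b c) s (s.setReg a (s.reg b + s.reg c)) 1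
  | sub (s : Config) (a b c : ℕ) : Runs (.sub a b c) s (s.setReg a (s.reg b - s.reg c)) 1
  | load (s : Config) (a b : ℕ) : Runs (.load a b) s (s.setReg a (s.mem (s.reg b))) 1
  | store (s : Config) (a b : ℕ) : Runs (.store a b) s (s.setMem (s.reg a) (s.reg b)) 1
  | seq {p q : Prog} {s s' s'' : Config} {t t' : ℕ} :
      Runs p s s' t → Runs q s' s'' t' → Runs (.seq p q) s s'' (t + t')
  | iteTrue {a : ℕ} {p q : Prog} {s s' : Config} {t : ℕ} :
      s.reg a ≠ 0 → Runs p s s' t → Runs (.ite a p q) s s' (t + 1)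
  | iteFalse {a : ℕ} {p q : Prog} {s s' : Config} {t : ℕ} :
      s.reg a = 0 → Runs q s s' t → Runs (.ite a p q) s s' (t + 1)
  | loopDone {a : ℕ} {p : Prog} {s : Config} :
      s.reg a = 0 → Runs (.loop a p) s s 1
  | loopStep {a : ℕ} {p : Prog} {s s' s'' : Config} {t t' : ℕ} :
      s.reg a ≠ 0 → Runs p s s' t → Runs (.loop a p) s' s'' t' →
        Runs (.loop a p) s s'' (t + t' + 1)

/-- `l` lists the edges of `G`, each exactly once, in any order and with any orientation. -/
def IsEdgeList {n : ℕ} (G : SimpleGraph (Fin n)) (l : List (Fin n × Fin n)) : Prop :=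
  (l.map fun e => s(e.1, e.2)).Nodup ∧
    ∀ e : Sym2 (Fin n), (e ∈ l.map fun e => s(e.1, e.2)) ↔ e ∈ G.edgeSet

/-- The initial configuration for a graph with vertices `0, …, n - 1` and edge list `l`: register
`0` holds the number of vertices, register `1` the number of edges, memory cells `2 * i` and
`2 * i + 1` hold the ends of the `i`-th edge, and everything else is `0`. -/
def inputConfig (n : ℕ) (l : List (Fin n × Fin n)) : Config where
  reg := fun a => if a = 0 then n else if a = 1 then l.length else 0
  mem := fun i => (l.flatMap fun e => [(e.1 : ℕ), (e.2 : ℕ)]).getD i 0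

end TrianglePath

/-! Equality. A set `S` is `t`-convex as soon as its vertices with neighbours outside form a clique
and every outside vertex has at most one neighbour in `S` (`tConvex_of_boundary`). Conversely,
convexity forces the second condition (`TConvex.eq_of_adj`), and the first for the neighbours in `S`
of each single component of `G - S` (`TConvex.adj_of_rIn`). The link to primality is
`IsAttached.isPrimeGraph`: a prime `G[U]` stays prime when a minimal connected set dominating a
suitable `A ⊆ U` is added. Hence the neighbours in an mp-subgraph of one outside component form a
clique, which makes every `F(C)` convex (`IsMPSubgraph.tConvex_extend`). In the other direction, let
`K` be a component of `G - S` and `Q` the clique of its neighbours. Adding to `Q` a minimal part of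
`K` that dominates it gives a prime graph. Any mp-subgraph `F` containing it lies in `Q ∪ K`, since
`Q` cannot separate it, and `S ⊆ F(Q)` (`TConvex.exists_extend`).

Algorithm. The complement of such a `K` is itself `t`-convex and contains `S`, so it suffices to
inspect sets `K` of this kind (`IsBlock`). If `Q` is a single vertex, `K` is a component of `G - Q`.
If `Q` contains distinct `q` and `r`, then `Q` lies in their common closed neighbourhood, while no
vertex of `K` is adjacent to both; so `K` is a component of `G` minus that neighbourhood
(`TConvex.exists_isBlock`). This leaves `n + m` sets to delete. For each, components are found by
relabelling in `O(n)` per edge, and each of the `n` possible labels is tested in `O(n + m)`, where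
being a clique is decided by counting edges. As `n ≤ m + 1`, the total is `O(nm²)`.

Correctness of the program is proved for a language of counting loops, `Code`, whose translation has
a step bound that can be read off the syntax (`runs_compile`). The predicate `Holds` ties memory to
labels and counts, and each routine preserves it. -/

namespace TrianglePath
open Relation

/-! ### Connections inside a set of vertices -/

section Connections
variable {V : Type*} {G : SimpleGraph V} {X Y : Set V} {a b c : V}

/-- `b` can be reached from `a` along edges with both ends in `X`. -/
def RIn (G : SimpleGraph V) (X : Set V) : V → V → Prop :=
  ReflTransGen fun a b => G.Adj a b ∧ a ∈ X ∧ b ∈ X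

theorem RIn.symm (h : RIn G X a b) : RIn G X b a := by
  induction h with
  | refl => exact .refl
  | tail _ h ih => exact ReflTransGen.head ⟨h.1.symm, h.2.2, h.2.1⟩ ih

theorem RIn.trans (h : RIn G X a b) (h' : RIn G X b c) : RIn G X a c := ReflTransGen.trans h h'

theorem RIn.mono (hXY : X ⊆ Y) (h : RIn G X a b) : RIn G Y a b :=
  ReflTransGen.mono (fun _ _ h => ⟨h.1, hXY h.2.1, hXY h.2.2⟩) _ _ h

theorem RIn.step (h : G.Adj a b) (ha : a ∈ X) (hb : b ∈ X) : RIn G X a b := .single ⟨h, ha, hb⟩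

theorem RIn.mem (h : RIn G X a b) (ha : a ∈ X) : b ∈ X := by
  induction h with
  | refl => exact ha
  | tail _ h _ => exact h.2.2

/-- A set without edges leaving it inside `X` is not left by connections inside `X`. -/
theorem RIn.mem_of_closed (h : RIn G X a b) (ha : a ∈ Y)
    (hY : ∀ y ∈ Y, ∀ z ∈ X, G.Adj y z → z ∈ Y) : b ∈ Y := by
  induction h with
  | refl => exact ha
  | tail _ h ih => exact hY _ ih _ h.2.2 h.1

/-- A connection inside `X` from a set `Y` that is closed inside `X` stays in `Y`. -/
theorem RIn.of_closed (h : RIn G X a b) (ha : a ∈ Y)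
    (hY : ∀ y ∈ Y, ∀ z ∈ X, G.Adj y z → z ∈ Y) : RIn G Y a b := by
  induction h with
  | refl => exact .refl
  | tail h' h ih =>
    have h1 := RIn.mem_of_closed h' ha hY
    exact ih.tail ⟨h.1, h1, hY _ h1 _ h.2.2 h.1⟩

theorem RIn.of_walk (p : G.Walk a b) (h : ∀ w ∈ p.support, w ∈ X) : RIn G X a b := by
  induction p with
  | nil => exact .refl
  | cons hadj p ih =>
    simp only [SimpleGraph.Walk.support_cons, List.mem_cons, forall_eq_or_imp] at h
    exact ReflTransGen.head ⟨hadj, h.1, h.2 _ p.start_mem_support⟩ (ih h.2)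

theorem RIn.exists_walk (h : RIn G X a b) (ha : a ∈ X) :
    ∃ p : G.Walk a b, ∀ w ∈ p.support, w ∈ X := by
  induction h with
  | refl => exact ⟨.nil, by simpa using ha⟩
  | tail _ h ih =>
    obtain ⟨p, hp⟩ := ih
    refine ⟨p.concat h.1, fun w hw => ?_⟩
    simp only [SimpleGraph.Walk.support_concat, List.mem_append,
      List.mem_singleton] at hw
    rcases hw with hw | rfl
    exacts [hp _ hw, h.2.2]

/-- A connection inside `X` that ends in `Y` meets `Y` for a first time. -/
theorem RIn.exists_first (h : RIn G X a b) (ha : a ∉ Y) (hb : b ∈ Y) :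
    ∃ d ∉ Y, ∃ e ∈ Y, e ∈ X ∧ G.Adj d e ∧ RIn G Yᶜ a d := by
  by_contra! hcon
  have h1 : RIn G Yᶜ a b := by
    clear hb
    induction h with
    | refl => exact .refl
    | tail h' h ih =>
      have hmem := RIn.mem ih ha
      refine ih.tail ⟨h.1, hmem, fun he => hcon _ hmem _ he h.2.2 h.1 ih⟩
  exact RIn.mem h1 ha hb

theorem rIn_induce {U : Set V} {C : Set U} {a b : U} :
    RIn (G.induce U) C a b ↔ RIn G (Subtype.val '' C) a b := by
  constructor
  · intro h
    induction h with
    | refl => exact .refl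
    | tail _ h ih =>
      exact ih.tail ⟨h.1, Set.mem_image_of_mem _ h.2.1, Set.mem_image_of_mem _ h.2.2⟩
  · obtain ⟨b, hb⟩ := b
    intro h
    simp only at h
    induction h with
    | refl => exact .refl
    | tail h' h ih =>
      obtain ⟨hadj, ⟨x, hx, rfl⟩, ⟨y, hy, rfl⟩⟩ := h
      exact (ih x.2).tail ⟨hadj, hx, hy⟩

/-- A shortest connection inside `X` is an induced path. -/
theorem RIn.exists_chordless (h : RIn G X a b) (ha : a ∈ X) :
    ∃ p : G.Walk a b, p.IsPath ∧ (∀ w ∈ p.support, w ∈ X) ∧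
      ∀ i j : ℕ, j ≤ p.length → i + 1 < j → ¬ G.Adj (p.getVert i) (p.getVert j) := by
  classical
  have hex : ∃ k, ∃ p : G.Walk a b, (∀ w ∈ p.support, w ∈ X) ∧ p.length = k := by
    obtain ⟨p, hp⟩ := h.exists_walk ha
    exact ⟨_, p, hp, rfl⟩
  obtain ⟨p, hp, hlen⟩ := Nat.find_spec hex
  have hmin : ∀ q : G.Walk a b, (∀ w ∈ q.support, w ∈ X) → p.length ≤ q.length :=
    fun q hq => hlen ▸ Nat.find_min' hex ⟨q, hq, rfl⟩
  have hsub : ∀ w ∈ p.bypass.support, w ∈ X :=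
    fun w hw => hp w (p.support_bypass_subset_support hw)
  have hle := p.length_bypass_le_length
  refine ⟨p.bypass, p.bypass_isPath, hsub, fun i j hj hij hadj => ?_⟩
  set q := p.bypass
  -- A chord would shorten the walk: the detour has length `i + 1 + (q.length - j)`.
  have := hmin ((q.take i).append (.cons hadj (q.drop j))) (by
    intro w hw
    rw [SimpleGraph.Walk.mem_support_append_iff, SimpleGraph.Walk.support_cons,
      List.mem_cons] at hw
    rcases hw with hw | rfl | hw
    · exact hsub w ((q.isSubwalk_take i).support_subset hw)
    · exact hsub _ (q.getVert_mem_support i)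
    · exact hsub w ((q.isSubwalk_drop j).support_subset hw))
  simp only [SimpleGraph.Walk.length_append, SimpleGraph.Walk.length_cons,
    SimpleGraph.Walk.take_length, SimpleGraph.Walk.drop_length] at this
  omega

end Connections

/-! ### Characterisation of `t`-convex sets -/

section Convex
variable {V : Type*} {G : SimpleGraph V} {S : Set V}

/-- The path `a, k, b` is too short to have a forbidden chord, whether or not `a` and `b` are
adjacent. -/
theorem TConvex.eq_of_adj (hS : TConvex G S) {k a b : V} (hk : k ∉ S) (ha : a ∈ S) (hb : b ∈ S)
    (hka : G.Adj k a) (hkb : G.Adj k b) : a = b := by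
  by_contra hab
  refine hk (hS a ha b hb (.cons hka.symm (.cons hkb .nil)) ⟨?_, fun i j hj hij => ?_⟩ k (by simp))
  · simp [SimpleGraph.Walk.cons_isPath_iff, hka.ne', hkb.ne, hab]
  · simp only [SimpleGraph.Walk.length_cons, SimpleGraph.Walk.length_nil] at hj
    omega

/-- Otherwise a chordless path from `a` to `b` with interior outside `S` has an interior vertex. It
is a triangle path, so convexity would put that vertex into `S`. -/
theorem TConvex.adj_of_rIn (hS : TConvex G S) {a b d e : V} (ha : a ∈ S) (hb : b ∈ S)
    (hab : a ≠ b) (hd : d ∉ S) (had : G.Adj a d) (hbe : G.Adj b e) (h : RIn G Sᶜ d e) :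
    G.Adj a b := by
  by_contra hnadj
  have he : e ∈ Sᶜ := h.mem hd
  obtain ⟨p, hp, hpX, hch⟩ := RIn.exists_chordless (X := insert a (insert b Sᶜ)) (a := a) (b := b)
    (((RIn.step had (by simp) (by simp [hd])).trans
      (h.mono fun x hx => by simp [show x ∉ S from hx])).trans
      (RIn.step hbe.symm (by simp [show e ∉ S from he]) (by simp))) (by simp)
  have hconv := hS a ha b hb p ⟨hp, fun i j hj hij => hch i j hj (by omega)⟩
  have hlen : 2 ≤ p.length := by
    by_contra hlt
    rcases Nat.lt_or_ge 0 p.length with h0 | h0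
    · have h1 : p.length = 1 := by omega
      exact hnadj (SimpleGraph.Walk.adj_of_length_eq_one h1)
    · exact hab (SimpleGraph.Walk.eq_of_length_eq_zero (p := p) (by omega))
  have h1 := hconv (p.getVert 1) (p.getVert_mem_support 1)
  have h2 := hpX (p.getVert 1) (p.getVert_mem_support 1)
  have hinj := hp.getVert_injOn
  have ha' : p.getVert 1 ≠ a := fun h => by
    have := hinj (show 1 ≤ p.length by omega) (show 0 ≤ p.length by omega) (by simpa using h)
    omega
  have hb' : p.getVert 1 ≠ b := fun h => by
    have := hinj (show 1 ≤ p.length by omega) (show p.length ≤ p.length by omega)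
      (by simpa using h)
    omega
  simp only [Set.mem_insert_iff, ha', hb', false_or] at h2
  exact h2 h1

/-- An excursion of a triangle path out of `S` leaves and re-enters at adjacent vertices. Hence it
consists of one vertex only, which then has two neighbours in `S`. -/
theorem tConvex_of_boundary (hcl : ∀ a ∈ S, ∀ b ∈ S, ∀ d ∉ S, ∀ e ∉ S, G.Adj a d → G.Adj b e →
      a ≠ b → G.Adj a b)
    (hone : ∀ k ∉ S, ∀ a ∈ S, ∀ b ∈ S, G.Adj k a → G.Adj k b → a = b) : TConvex G S := by
  classical
  intro u hu v hv p hp w hw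
  by_contra hwS
  obtain ⟨i, rfl, hi⟩ := SimpleGraph.Walk.mem_support_iff_exists_getVert.1 hw
  have hi0 : i ≠ 0 := by rintro rfl; simp [hu] at hwS
  have hil : i < p.length := lt_of_le_of_ne hi (by rintro rfl; simp [hv] at hwS)
  let P := fun j => p.getVert j ∈ S
  -- `j` is the last position before `i`, and `k` below the first after `i`, at which the path is in
  -- `S`.
  have hj := Nat.findGreatest_spec (P := P) (n := i) (m := 0) (by omega) (by simpa [P] using hu)
  have hjle := Nat.findGreatest_le (P := P) i
  have hjgt : ∀ k, Nat.findGreatest P i < k → k ≤ i → ¬ P k :=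
    fun k h h' => Nat.findGreatest_is_greatest h h'
  have hjne : Nat.findGreatest P i ≠ i := fun h => hwS (h ▸ hj)
  generalize Nat.findGreatest P i = j at *
  have hex : ∃ k, i ≤ k ∧ P k := ⟨p.length, hi, by simpa [P] using hv⟩
  obtain ⟨hik, hk⟩ := Nat.find_spec hex
  have hkl : Nat.find hex ≤ p.length := Nat.find_min' hex ⟨hi, by simpa [P] using hv⟩
  have hklt : ∀ l, i ≤ l → l < Nat.find hex → ¬ P l :=
    fun l h h' h'' => Nat.find_min hex h' ⟨h, h''⟩
  generalize Nat.find hex = k at *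
  have hki : k ≠ i := by rintro rfl; exact hwS hk
  have h1 : p.getVert (j + 1) ∉ S := hjgt _ (by omega) (by omega)
  have h2 : p.getVert (k - 1) ∉ S := hklt _ (by omega) (by omega)
  have a1 := p.adj_getVert_succ (i := j) (by omega)
  have a2 := p.adj_getVert_succ (i := k - 1) (by omega)
  rw [show k - 1 + 1 = k by omega] at a2
  have hne : p.getVert j ≠ p.getVert k := fun h => by
    have := hp.1.getVert_injOn (show j ≤ p.length by omega) (show k ≤ p.length by omega) h
    omega
  have hadj := hcl _ hj _ hk _ h1 _ h2 a1 a2.symm hne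
  have hkj : ¬ j + 2 < k := fun h => hp.2 j k hkl h hadj
  rw [show k - 1 = j + 1 by omega] at a2
  exact hne (hone _ h1 _ hj _ hk a1.symm a2)

end Convex

/-! ### Prime graphs -/

section Prime
variable {V : Type*} {G : SimpleGraph V}

theorem isPrimeGraph_iff :
    IsPrimeGraph G ↔ ∀ T, G.IsClique T → ∀ a ∉ T, ∀ b ∉ T, RIn G Tᶜ a b := by
  classical
  constructor
  · intro h T hT a ha b hb
    by_contra hab
    refine h T hT ⟨a, ha, b, hb, fun p _ => ?_⟩
    by_contra! hp
    exact hab (RIn.of_walk p hp)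
  · rintro h T hT ⟨a, ha, b, hb, hp⟩
    obtain ⟨p, hpT⟩ := (h T hT a ha b hb).exists_walk ha
    obtain ⟨w, hw, hwT⟩ := hp p.bypass p.bypass_isPath
    exact hpT w (p.support_bypass_subset_support hw) hwT

theorem isPrimeGraph_induce_iff {U : Set V} :
    IsPrimeGraph (G.induce U) ↔
      ∀ T, G.IsClique T → ∀ a ∈ U \ T, ∀ b ∈ U \ T, RIn G (U \ T) a b := by
  rw [isPrimeGraph_iff]
  constructor
  · intro h T hT a ha b hb
    have := rIn_induce.1 (h (Subtype.val ⁻¹' T) (fun x hx y hy hxy => hT hx hy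
      (Subtype.val_injective.ne hxy)) ⟨a, ha.1⟩ ha.2 ⟨b, hb.1⟩ hb.2)
    refine this.mono ?_
    rintro _ ⟨x, hx, rfl⟩
    exact ⟨x.2, hx⟩
  · intro h T hT a ha b hb
    have hmem : ∀ x : U, x ∉ T → (x : V) ∈ U \ Subtype.val '' T := fun x hx =>
      ⟨x.2, by rintro ⟨y, hy, hyx⟩; exact hx (Subtype.val_injective hyx ▸ hy)⟩
    have := h (Subtype.val '' T) (by
      rintro _ ⟨x, hx, rfl⟩ _ ⟨y, hy, rfl⟩ hxy
      exact hT hx hy fun h => hxy (by rw [h])) a (hmem a ha) b (hmem b hb)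
    refine rIn_induce.2 (this.mono ?_)
    rintro x ⟨hxU, hx⟩
    exact ⟨⟨x, hxU⟩, fun h => hx ⟨_, h, rfl⟩, rfl⟩

theorem isPrimeGraph_induce_of_isClique {Q : Set V} (hQ : G.IsClique Q) :
    IsPrimeGraph (G.induce Q) := by
  rw [isPrimeGraph_induce_iff]
  intro T _ a ha b hb
  rcases eq_or_ne a b with rfl | hab
  · exact .refl
  · exact .step (hQ ha.1 hb.1 hab) ha hb

/-- `D` is a nonempty connected set disjoint from `U` that dominates `A`. -/
structure IsAttached (G : SimpleGraph V) (U A D : Set V) : Prop where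
  nonempty : D.Nonempty
  disjoint : ∀ d ∈ D, d ∉ U
  conn : ∀ x ∈ D, ∀ y ∈ D, RIn G D x y
  dom : ∀ a ∈ A, ∃ d ∈ D, G.Adj a d

/-- Deleting from `D` a component `B` of `(U ∪ D) \ T`, for a clique `T` meeting `D`, gives a
smaller attached set. -/
theorem IsAttached.diff {U A D T B : Set V} (hD : IsAttached G U A D) (hAU : A ⊆ U)
    (hT : G.IsClique T) {t : V} (htT : t ∈ T) (htD : t ∈ D) (hBD : B ⊆ D) (hBT : ∀ x ∈ B, x ∉ T)
    (hB : ∀ x ∈ B, ∀ y ∈ (U ∪ D) \ T, G.Adj x y → y ∈ B) : IsAttached G U A (D \ B) := by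
  refine ⟨⟨t, htD, fun h => hBT t h htT⟩, fun d hd => hD.disjoint d hd.1, ?_, ?_⟩
  · intro y hy z hz
    -- A connection in `D` can enter or leave `B` only through `T`. Since `T` is a clique, the entry
    -- and exit vertices are equal or adjacent, and the visit to `B` can be skipped.
    have key : ∀ z, RIn G D y z → (z ∈ D \ B ∧ RIn G (D \ B) y z) ∨
        (z ∈ B ∧ ∃ s ∈ T, s ∈ D ∧ RIn G (D \ B) y s) := by
      intro z h
      induction h with
      | refl => exact .inl ⟨hy, .refl⟩
      | @tail z z' _ h ih =>
        obtain ⟨hadj, hz, hz'⟩ := h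
        by_cases hz'B : z' ∈ B
        · refine .inr ⟨hz'B, ?_⟩
          rcases ih with ⟨h1, h2⟩ | ⟨_, h2⟩
          · by_cases hzT : z ∈ T
            · exact ⟨z, hzT, hz, h2⟩
            · exact absurd (hB z' hz'B z ⟨.inr hz, hzT⟩ hadj.symm) h1.2
          · exact h2
        · refine .inl ⟨⟨hz', hz'B⟩, ?_⟩
          rcases ih with ⟨h1, h2⟩ | ⟨h1, s, hsT, hsD, hs⟩
          · exact h2.tail ⟨hadj, h1, hz', hz'B⟩
          · have hz'T : z' ∈ T := by
              by_contra hn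
              exact hz'B (hB z h1 z' ⟨.inr hz', hn⟩ hadj)
            rcases eq_or_ne s z' with rfl | hne
            · exact hs
            · exact hs.tail ⟨hT hsT hz'T hne, ⟨hsD, fun h => hBT s h hsT⟩, hz', hz'B⟩
    rcases key z (hD.conn y hy.1 z hz.1) with h | h
    · exact h.2
    · exact absurd h.1 hz.2
  · intro a ha
    by_cases haT : a ∈ T
    · refine ⟨t, ⟨htD, fun h => hBT t h htT⟩, hT haT htT ?_⟩
      rintro rfl
      exact hD.disjoint _ htD (hAU ha)
    · obtain ⟨d, hd, had⟩ := hD.dom a ha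
      refine ⟨d, ⟨hd, fun hdB => ?_⟩, had⟩
      exact hD.disjoint a (hBD (hB d hdB a ⟨.inl (hAU ha), haT⟩ had.symm)) (hAU ha)

/-- Adding a minimal attached set to a prime induced subgraph gives a prime induced subgraph. -/
theorem IsAttached.isPrimeGraph {U A D : Set V} (hU : IsPrimeGraph (G.induce U)) (hAU : A ⊆ U)
    (hA : G.IsClique A → A = U) (hD : Minimal (IsAttached G U A) D) :
    IsPrimeGraph (G.induce (U ∪ D)) := by
  rw [isPrimeGraph_induce_iff] at hU ⊢
  intro T hT
  -- In this case `A` is a clique, so `U = A ⊆ T` and only vertices of the connected set `D` remain.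
  -- In the other case every remaining vertex is joined to `U \ T`, which is connected because
  -- `G[U]` is prime.
  by_cases hTD : A ⊆ T ∧ ∀ t ∈ T, t ∉ D
  · obtain ⟨hAT, hTD⟩ := hTD
    have hUA := hA (hT.subset hAT)
    have hmem : ∀ a ∈ (U ∪ D) \ T, a ∈ D := fun a ha =>
      ha.1.resolve_left fun h => ha.2 (hAT (hUA ▸ h))
    intro a ha b hb
    exact (hD.prop.conn a (hmem a ha) b (hmem b hb)).mono
      fun x hx => ⟨.inr hx, fun h => hTD x h hx⟩
  · have key : ∀ x ∈ (U ∪ D) \ T, ∃ y ∈ U \ T, RIn G ((U ∪ D) \ T) x y := by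
      intro x hx
      by_contra! hcon
      have hBD : {y | RIn G ((U ∪ D) \ T) x y} ⊆ D := fun y hy =>
        (RIn.mem hy hx).1.resolve_left fun h => hcon y ⟨h, (RIn.mem hy hx).2⟩ hy
      -- The component of `x` lies in `D`. If `T` meets `D`, removing the component contradicts
      -- minimality. Otherwise all of `D` survives and is adjacent to a vertex of `A \ T`.
      by_cases hTD' : ∃ t ∈ T, t ∈ D
      · obtain ⟨t, htT, htD⟩ := hTD'
        have hatt := hD.prop.diff hAU hT htT htD hBD (fun y hy => (RIn.mem hy hx).2)
          (fun y hy z hz hyz => ReflTransGen.tail hy ⟨hyz, RIn.mem hy hx, hz⟩)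
        exact (hD.le_of_le hatt Set.sdiff_subset (hBD (a := x) .refl)).2 .refl
      · push Not at hTD'
        have hAT : ¬ A ⊆ T := fun h => hTD ⟨h, hTD'⟩
        obtain ⟨a, haA, haT⟩ := Set.not_subset.1 hAT
        obtain ⟨d, hd, had⟩ := hD.prop.dom a haA
        have hsub : D ⊆ (U ∪ D) \ T := fun z hz => ⟨.inr hz, fun h => hTD' z h hz⟩
        exact hcon a ⟨hAU haA, haT⟩ (((hD.prop.conn x (hBD (a := x) .refl) d hd).mono hsub).trans
          (.step had.symm (hsub hd) ⟨.inl (hAU haA), haT⟩))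
    intro a ha b hb
    obtain ⟨a', ha', haa'⟩ := key a ha
    obtain ⟨b', hb', hbb'⟩ := key b hb
    exact haa'.trans (((hU T hT a' ha' b' hb').mono
      (Set.sdiff_subset_sdiff_left Set.subset_union_left)).trans hbb'.symm)

/-- Two neighbours in an `mp`-subgraph `U` of one component of `G - U` are adjacent. -/
theorem IsMPSubgraph.adj_of_rIn [Finite V] {U : Set V} (hU : IsMPSubgraph G U) {a b d e : V}
    (ha : a ∈ U) (hb : b ∈ U) (hab : a ≠ b) (hd : d ∉ U) (had : G.Adj a d) (hbe : G.Adj b e)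
    (h : RIn G Uᶜ d e) : G.Adj a b := by
  by_contra hnadj
  -- The whole component of `G - U` is attached to `{a, b}`; a minimal attached set would enlarge
  -- `U` to a bigger prime graph.
  have hK : IsAttached G U {a, b} {x | RIn G Uᶜ d x} := by
    refine ⟨⟨d, .refl⟩, fun x hx => RIn.mem hx hd, fun x hx y hy => ?_, ?_⟩
    · exact (RIn.symm hx |>.trans hy).of_closed hx
        fun y hy z hz hyz => ReflTransGen.tail hy ⟨hyz, RIn.mem hy hd, hz⟩
    · simp only [Set.mem_insert_iff, Set.mem_singleton_iff, forall_eq_or_imp, forall_eq]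
      exact ⟨⟨d, .refl, had⟩, ⟨e, h, hbe⟩⟩
  obtain ⟨D, _, hD⟩ := Finite.exists_le_minimal hK
  have hprime := IsAttached.isPrimeGraph hU.prop (by rintro x (rfl | rfl) <;> assumption)
    (fun hc => absurd (hc (by simp) (by simp) hab) hnadj) hD
  obtain ⟨x, hx⟩ := hD.prop.nonempty
  exact hD.prop.disjoint x hx (hU.le_of_ge hprime Set.subset_union_left (.inr hx))

/-- Proper `t`-convex sets of a prime graph are cliques with connected complement. -/
theorem IsPrimeGraph.of_tConvex (hG : IsPrimeGraph G) {C : Set V} (hC : TConvex G C) :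
    G.IsClique C ∨ C = Set.univ := by
  rw [or_iff_not_imp_right]
  intro hne
  obtain ⟨x, hx⟩ := (Set.ne_univ_iff_exists_notMem C).1 hne
  rw [isPrimeGraph_iff] at hG
  -- The neighbours in `C` of the component of `x` form a clique, and this clique would separate `x`
  -- from any further vertex of `C`.
  let N : Set V := {a | a ∈ C ∧ ∃ k, RIn G Cᶜ x k ∧ G.Adj a k}
  have hN : G.IsClique N := by
    rintro a ⟨ha, k, hk, hak⟩ b ⟨hb, l, hl, hbl⟩ hab
    exact hC.adj_of_rIn ha hb hab (hk.mem hx) hak hbl (hk.symm.trans hl)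
  refine hN.subset fun c hc => ?_
  by_contra hcN
  have h1 := hG N hN x (fun h => hx h.1) c hcN
  have h2 := h1.mem_of_closed (Y := {y | RIn G Cᶜ x y}) .refl fun y hy z hz hyz =>
    ReflTransGen.tail hy ⟨hyz, RIn.mem hy hx, fun hzC => hz ⟨hzC, y, hy, hyz.symm⟩⟩
  exact RIn.mem h2 hx hc

end Prime

/-! ### The equality of the two numbers -/

section Main
variable {V : Type*} {G : SimpleGraph V}

theorem notMem_extend_iff {U C : Set V} {v : V} :
    v ∉ extend G U C ↔ v ∉ C ∧ ∃ u ∈ U \ C, RIn G Cᶜ v u := by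
  have himg : ∀ {a b : (Cᶜ : Set V)},
      (G.induce Cᶜ).Reachable a b ↔ RIn G Cᶜ a b := by
    intro a b
    have := rIn_induce (G := G) (C := Set.univ) (a := a) (b := b)
    rw [Set.image_univ, Subtype.range_coe] at this
    rw [← this, SimpleGraph.reachable_iff_reflTransGen, RIn]
    simp only [Set.mem_univ, and_true]
  simp only [extend, Set.mem_union, not_or, Set.mem_ofPred_eq, not_exists, not_and]
  refine and_congr_right fun hv => ⟨fun h => ?_, ?_⟩
  · have := h ((G.induce Cᶜ).connectedComponentMk ⟨v, hv⟩) ⟨⟨v, hv⟩, rfl, rfl⟩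
    obtain ⟨_, ⟨⟨u, huC⟩, hu, rfl⟩, huU⟩ := Set.not_disjoint_iff.1 this
    rw [SimpleGraph.ConnectedComponent.mem_supp_iff, SimpleGraph.ConnectedComponent.eq, himg] at hu
    exact ⟨u, huU, hu.symm⟩
  · rintro ⟨u, hu, hvu⟩ K ⟨⟨_, hv'⟩, rfl, rfl⟩ hdis
    refine Set.disjoint_left.1 hdis ⟨⟨u, hu.2⟩, ?_, rfl⟩ hu
    rw [SimpleGraph.ConnectedComponent.mem_supp_iff, SimpleGraph.ConnectedComponent.eq, himg]
    exact hvu.symm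

/-- Edges leaving `F(C)` start in the clique `C`, so only the one-neighbour condition needs work,
and only for vertices outside `F`. -/
theorem IsMPSubgraph.tConvex_extend [Finite V] {U : Set V} (hU : IsMPSubgraph G U) {C : Set U}
    (hC : TConvex (G.induce U) C) (hne : C ≠ Set.univ) :
    TConvex G (extend G U (Subtype.val '' C)) ∧ extend G U (Subtype.val '' C) ≠ Set.univ := by
  have hclH := (IsPrimeGraph.of_tConvex hU.prop hC).resolve_right hne
  have hmemC : ∀ x : U, (x : V) ∈ Subtype.val '' C ↔ x ∈ C := fun x => by simp
  have hone : ∀ k ∈ U \ Subtype.val '' C, ∀ a ∈ Subtype.val '' C, ∀ b ∈ Subtype.val '' C,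
      G.Adj k a → G.Adj k b → a = b := by
    rintro k ⟨hkU, hk⟩ _ ⟨a, ha, rfl⟩ _ ⟨b, hb, rfl⟩ hka hkb
    exact congrArg _ (hC.eq_of_adj (k := ⟨k, hkU⟩) (fun h => hk ⟨_, h, rfl⟩) ha hb hka hkb)
  have hcl : G.IsClique (Subtype.val '' C) := by
    rintro _ ⟨a, ha, rfl⟩ _ ⟨b, hb, rfl⟩ hab
    exact hclH ha hb fun h => hab (by rw [h])
  have hCU : Subtype.val '' C ⊆ U := by rintro _ ⟨a, _, rfl⟩; exact a.2
  obtain ⟨x, hx⟩ := (Set.ne_univ_iff_exists_notMem C).1 hne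
  generalize hC' : Subtype.val '' C = C' at *
  have hbd : ∀ s ∈ extend G U C', ∀ k ∉ extend G U C', G.Adj k s → s ∈ C' := by
    intro s hs k hk hks
    by_contra hsC
    obtain ⟨hkC, u, hu, hku⟩ := notMem_extend_iff.1 hk
    exact notMem_extend_iff.2 ⟨hsC, u, hu, (RIn.step hks.symm hsC hkC).trans hku⟩ hs
  constructor
  · refine tConvex_of_boundary (fun a ha b hb d hd e he had hbe hab => ?_)
      fun k hk a ha b hb hka hkb => ?_
    · exact hcl (hbd a ha d hd had.symm) (hbd b hb e he hbe.symm) hab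
    · have haC := hbd a ha k hk hka
      have hbC := hbd b hb k hk hkb
      obtain ⟨hkC, u, hu, hku⟩ := notMem_extend_iff.1 hk
      by_cases hkU : k ∈ U
      · exact hone k ⟨hkU, hkC⟩ a haC b hbC hka hkb
      · obtain ⟨d, hd, e, he, heC, hde, hkd⟩ := hku.exists_first hkU hu.1
        have hea : e ≠ a := by rintro rfl; exact heC haC
        have heb : e ≠ b := by rintro rfl; exact heC hbC
        exact hone e ⟨he, heC⟩ a haC b hbC
          (hU.adj_of_rIn he (hCU haC) hea hd hde.symm hka.symm hkd.symm)
          (hU.adj_of_rIn he (hCU hbC) heb hd hde.symm hkb.symm hkd.symm)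
  · intro h
    have hxC : (x : V) ∉ C' := fun h => hx ((hmemC x).1 h)
    exact notMem_extend_iff.2 ⟨hxC, x, ⟨x.2, hxC⟩, .refl⟩ (h ▸ Set.mem_univ _)

/-- The set `C` is the clique `Q` of neighbours of a component `K` of `G - S`. The mp-subgraph is
grown from `Q` and a minimal part of `K` dominating it. -/
theorem TConvex.exists_extend [Finite V] {S : Set V} (hS : TConvex G S) (hne : S ≠ Set.univ) :
    ∃ U : Set V, IsMPSubgraph G U ∧ ∃ C : Set U, TConvex (G.induce U) C ∧ C ≠ Set.univ ∧
      S ⊆ extend G U (Subtype.val '' C) := by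
  obtain ⟨x, hx⟩ := (Set.ne_univ_iff_exists_notMem S).1 hne
  let K : Set V := {y | RIn G Sᶜ x y}
  let Q : Set V := {a | a ∈ S ∧ ∃ k ∈ K, G.Adj a k}
  have hKS : ∀ k ∈ K, k ∉ S := fun k hk => RIn.mem hk hx
  have hQ : G.IsClique Q := by
    rintro a ⟨ha, k, hk, hak⟩ b ⟨hb, l, hl, hbl⟩ hab
    exact hS.adj_of_rIn ha hb hab (hKS k hk) hak hbl (RIn.symm hk |>.trans hl)
  have hclS : ∀ y ∈ K, ∀ z ∈ Sᶜ, G.Adj y z → z ∈ K := fun y hy z hz hyz =>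
    ReflTransGen.tail hy ⟨hyz, hKS y hy, hz⟩
  have hclQ : ∀ y ∈ K, ∀ z ∈ Qᶜ, G.Adj y z → z ∈ K := fun y hy z hz hyz =>
    hclS y hy z (fun h => hz ⟨h, y, hy, hyz.symm⟩) hyz
  have hK : IsAttached G Q Q K :=
    ⟨⟨x, .refl⟩, fun k hk h => hKS k hk h.1,
      fun y hy z hz => (RIn.symm hy |>.trans hz).of_closed hy hclS, fun a ha => ha.2⟩
  obtain ⟨D, hDK, hD⟩ := Finite.exists_le_minimal hK
  have hprime := IsAttached.isPrimeGraph (isPrimeGraph_induce_of_isClique hQ) subset_rfl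
    (fun _ => rfl) hD
  obtain ⟨U, hDU, hU⟩ := Finite.exists_le_maximal (p := fun W : Set V => IsPrimeGraph (G.induce W))
    hprime
  obtain ⟨d, hd⟩ := hD.prop.nonempty
  have hdU : d ∈ U := hDU (.inr hd)
  have hdQ : d ∉ Q := hD.prop.disjoint d hd
  -- The clique `Q` does not separate `U`, and `K` can be left only through `Q`.
  have hUK : ∀ u ∈ U \ Q, u ∈ K := fun u hu =>
    RIn.mem_of_closed (isPrimeGraph_induce_iff.1 hU.prop Q hQ d ⟨hdU, hdQ⟩ u hu) (hDK hd)
      fun y hy z hz => hclQ y hy z hz.2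
  have himg : Subtype.val '' (Subtype.val ⁻¹' Q : Set U) = Q := by
    rw [Subtype.image_preimage_coe, Set.inter_eq_right]
    exact Set.subset_union_left.trans hDU
  refine ⟨U, hU, Subtype.val ⁻¹' Q, tConvex_of_boundary ?_ ?_, ?_, ?_⟩
  · intro a ha b hb _ _ _ _ _ _ hab
    exact hQ ha hb (Subtype.val_injective.ne hab)
  · intro k hk a ha b hb hka hkb
    exact Subtype.val_injective
      (hS.eq_of_adj (hKS k (hUK k ⟨k.2, hk⟩)) ha.1 hb.1 hka hkb)
  · exact (Set.ne_univ_iff_exists_notMem _).2 ⟨⟨d, hdU⟩, hdQ⟩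
  · rw [himg]
    intro s hs
    by_contra hcon
    obtain ⟨_, u, hu, hsu⟩ := notMem_extend_iff.1 hcon
    exact hKS s (hsu.symm.mem_of_closed (hUK u hu) hclQ) hs

theorem tConvex_empty : TConvex G ∅ := by simp [TConvex]

theorem isGreatest_tConvexityNumber [Finite V] [Nonempty V] (G : SimpleGraph V) :
    IsGreatest (properTConvexSizes G) (tConvexityNumber G) := by
  have hb : BddAbove (properTConvexSizes G) :=
    ⟨Nat.card V, by rintro _ ⟨S, _, _, rfl⟩; exact Set.ncard_le_card S⟩
  exact ⟨Nat.sSup_mem ⟨_, ∅, tConvex_empty, Set.empty_ne_univ, rfl⟩ hb, fun _ h => le_csSup hb h⟩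

theorem isGreatest_cNumber [Finite V] [Nonempty V] (G : SimpleGraph V) :
    IsGreatest (extendSizes G) (cNumber G) := by
  have hb : BddAbove (extendSizes G) :=
    ⟨Nat.card V, by rintro _ ⟨U, _, C, _, _, rfl⟩; exact Set.ncard_le_card _⟩
  obtain ⟨U, hU, C, hC, hne, _⟩ := (tConvex_empty (G := G)).exists_extend Set.empty_ne_univ
  exact ⟨Nat.sSup_mem ⟨_, U, hU, C, hC, hne, rfl⟩ hb, fun _ h => le_csSup hb h⟩

theorem tConvexityNumber_eq_cNumber [Finite V] [Nonempty V] (G : SimpleGraph V) :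
    tConvexityNumber G = cNumber G := by
  apply le_antisymm
  · obtain ⟨S, hS, hne, hcard⟩ := (isGreatest_tConvexityNumber G).1
    obtain ⟨U, hU, C, hC, hCne, hsub⟩ := hS.exists_extend hne
    rw [← hcard]
    exact (Set.ncard_le_ncard hsub).trans ((isGreatest_cNumber G).2 ⟨U, hU, C, hC, hCne, rfl⟩)
  · obtain ⟨U, hU, C, hC, hne, hcard⟩ := (isGreatest_cNumber G).1
    obtain ⟨h1, h2⟩ := hU.tConvex_extend hC hne
    exact (isGreatest_tConvexityNumber G).2 ⟨_, h1, h2, hcard⟩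

end Main

/-! ### Programs with counting loops -/

section Machine

@[simp] theorem Config.reg_setReg (s : Config) (a x b : ℕ) :
    (s.setReg a x).reg b = if b = a then x else s.reg b := by
  simp [Config.setReg, Function.update_apply]

@[simp] theorem Config.mem_setReg (s : Config) (a x : ℕ) : (s.setReg a x).mem = s.mem := rfl

@[simp] theorem Config.reg_setMem (s : Config) (i x : ℕ) : (s.setMem i x).reg = s.reg := rfl

@[simp] theorem Config.mem_setMem (s : Config) (i x j : ℕ) :
    (s.setMem i x).mem j = if j = i then x else s.mem j := by
  simp [Config.setMem, Function.update_apply]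

/-- Programs whose only loops run a register `i` through `0, …, N - 1`, where `N` is the content
of a register `b` at the start of the loop. -/
inductive Code where
  | skip : Code
  | const (a k : ℕ) : Code
  | copy (a b : ℕ) : Code
  | add (a b c : ℕ) : Code
  | sub (a b c : ℕ) : Code
  | load (a b : ℕ) : Code
  | store (a b : ℕ) : Code
  | seq (p q : Code) : Code
  | ite (a : ℕ) (p q : Code) : Code
  | loop (b i : ℕ) (p : Code) : Code

/-- Sequences of programs. -/
infixr:60 " ;; " => Code.seq

namespace Code

/-- The translation into programs. Register `2` has to hold `1`, and register `3` is used to test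
whether a loop has ended. -/
def compile : Code → Prog
  | skip => .skip
  | const a k => .const a k
  | copy a b => .copy a b
  | add a b c => .add a b c
  | sub a b c => .sub a b c
  | load a b => .load a b
  | store a b => .store a b
  | seq p q => .seq p.compile q.compile
  | ite a p q => .ite a p.compile q.compile
  | .loop b i p => .seq (.const i 0) (.seq (.sub 3 b i)
      (.loop 3 (.seq p.compile (.seq (.add i i 2) (.sub 3 b i)))))

/-- The configuration before the `k`-th round of a loop with body `f`. -/
def loopState (f : Config → Config) (i N : ℕ) (s : Config) : ℕ → Config
  | 0 => (s.setReg i 0).setReg 3 N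
  | k + 1 => ((f (loopState f i N s k)).setReg i (k + 1)).setReg 3 (N - (k + 1))

/-- The configuration in which a program halts. -/
def eval : Code → Config → Config
  | skip, s => s
  | const a k, s => s.setReg a k
  | copy a b, s => s.setReg a (s.reg b)
  | add a b c, s => s.setReg a (s.reg b + s.reg c)
  | sub a b c, s => s.setReg a (s.reg b - s.reg c)
  | load a b, s => s.setReg a (s.mem (s.reg b))
  | store a b, s => s.setMem (s.reg a) (s.reg b)
  | seq p q, s => q.eval (p.eval s)
  | ite a p q, s => if s.reg a = 0 then q.eval s else p.eval s
  | .loop b i p, s => loopState p.eval i (s.reg b) s (s.reg b)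

/-- The registers that a program may change. -/
def writes : Code → List ℕ
  | skip => []
  | const a _ => [a]
  | copy a _ => [a]
  | add a _ _ => [a]
  | sub a _ _ => [a]
  | load a _ => [a]
  | store _ _ => []
  | seq p q => p.writes ++ q.writes
  | ite _ p q => p.writes ++ q.writes
  | .loop _ i p => i :: 3 :: p.writes

/-- All loops are bounded by register `0` or `1`, and loop variables are not changed by the bodies
of the loops. -/
def Regular : Code → Prop
  | seq p q => p.Regular ∧ q.Regular
  | ite _ p q => p.Regular ∧ q.Regular
  | .loop b i p => b < 2 ∧ 3 < i ∧ i ∉ p.writes ∧ p.Regular ∧ ∀ a ∈ p.writes, 2 < a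
  | _ => True

instance decidableRegular : DecidablePred Regular
  | seq p q => @instDecidableAnd _ _ (decidableRegular p) (decidableRegular q)
  | ite _ p q => @instDecidableAnd _ _ (decidableRegular p) (decidableRegular q)
  | .loop b i p =>
    have := decidableRegular p
    inferInstanceAs (Decidable (b < 2 ∧ 3 < i ∧ i ∉ p.writes ∧ p.Regular ∧ ∀ a ∈ p.writes, 2 < a))
  | skip | const _ _ | copy _ _ | add _ _ _ | sub _ _ _ | load _ _ | store _ _ =>
    inferInstanceAs (Decidable True)

/-- A bound on the number of steps, for the contents `n` and `m` of the registers `0` and `1`. -/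
def bound (n m : ℕ) : Code → ℕ
  | seq p q => p.bound n m + q.bound n m
  | ite _ p q => p.bound n m + q.bound n m + 1
  | .loop b _ p => (if b = 0 then n else m) * (p.bound n m + 3) + 3
  | _ => 1

theorem eval_reg {p : Code} {a : ℕ} (h : a ∉ p.writes) (s : Config) :
    (p.eval s).reg a = s.reg a := by
  induction p generalizing s with
  | seq p q ihp ihq =>
    simp only [writes, List.mem_append, not_or] at h
    rw [eval, ihq h.2, ihp h.1]
  | ite b p q ihp ihq =>
    simp only [writes, List.mem_append, not_or] at h
    rw [eval]
    split_ifs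
    exacts [ihq h.2 s, ihp h.1 s]
  | loop b i p ih =>
    simp only [writes, List.mem_cons, not_or] at h
    rw [eval]
    generalize s.reg b = N
    suffices ∀ k, (loopState p.eval i N s k).reg a = s.reg a from this N
    intro k
    induction k with
    | zero => simp [loopState, h]
    | succ k ih' => simp [loopState, h, ih h.2.2, ih']
  | _ => simp_all [eval, writes]

/-- Registers `0`, `1` and `2` are never written, so the loop bounds and the increment stay fixed. A
round costs its body plus three steps: increment, subtraction and test. Initialisation and the final
test give the other three. -/
theorem runs_compile {p : Code} (hp : p.Regular) (hw : ∀ a ∈ p.writes, 2 < a) (s : Config)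
    (h2 : s.reg 2 = 1) :
    ∃ t ≤ p.bound (s.reg 0) (s.reg 1), Runs p.compile s (p.eval s) t := by
  induction p generalizing s with
  | skip => exact ⟨1, le_rfl, .skip s⟩
  | const a k => exact ⟨1, le_rfl, .const s a k⟩
  | copy a b => exact ⟨1, le_rfl, .copy s a b⟩
  | add a b c => exact ⟨1, le_rfl, .add s a b c⟩
  | sub a b c => exact ⟨1, le_rfl, .sub s a b c⟩
  | load a b => exact ⟨1, le_rfl, .load s a b⟩
  | store a b => exact ⟨1, le_rfl, .store s a b⟩
  | seq p q ihp ihq =>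
    simp only [writes, List.mem_append, or_imp, forall_and] at hw
    have hpw : ∀ a < 3, (p.eval s).reg a = s.reg a := fun a ha =>
      eval_reg (fun h => by have := hw.1 a h; omega) s
    obtain ⟨t, ht, hr⟩ := ihp hp.1 hw.1 s h2
    obtain ⟨t', ht', hr'⟩ := ihq hp.2 hw.2 (p.eval s) (by rw [hpw 2 (by omega), h2])
    rw [hpw 0 (by omega), hpw 1 (by omega)] at ht'
    exact ⟨t + t', add_le_add ht ht', .seq hr hr'⟩
  | ite a p q ihp ihq =>
    simp only [writes, List.mem_append, or_imp, forall_and] at hw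
    by_cases ha : s.reg a = 0
    · obtain ⟨t, ht, hr⟩ := ihq hp.2 hw.2 s h2
      refine ⟨t + 1, by rw [bound]; omega, ?_⟩
      rw [eval, if_pos ha]
      exact .iteFalse ha hr
    · obtain ⟨t, ht, hr⟩ := ihp hp.1 hw.1 s h2
      refine ⟨t + 1, by rw [bound]; omega, ?_⟩
      rw [eval, if_neg ha]
      exact .iteTrue ha hr
  | loop b i p ih =>
    obtain ⟨hb, hi, hip, hpr, hpw⟩ := hp
    set B := p.bound (s.reg 0) (s.reg 1) with hB
    set N := s.reg b with hN
    have hfr : ∀ k, ∀ a < 3, (loopState p.eval i N s k).reg a = s.reg a := by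
      intro k a ha
      induction k with
      | zero => simp [loopState, show a ≠ 3 by omega, show a ≠ i by omega]
      | succ k ih =>
        simp only [loopState, Config.reg_setReg, show a ≠ 3 by omega, show a ≠ i by omega,
          if_false]
        rw [eval_reg (fun h => by have := hpw a h; omega), ih]
    have hki : ∀ k, (loopState p.eval i N s k).reg i = k := by
      intro k
      cases k <;> simp [loopState, show i ≠ 3 by omega]
    have hk3 : ∀ k, (loopState p.eval i N s k).reg 3 = N - k := by
      intro k
      cases k <;> simp [loopState]
    -- Induction on the number `d` of rounds still to run; register `3` then contains `N - k = d`.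
    have key : ∀ d k, k + d = N → ∃ t ≤ d * (B + 3) + 1,
        Runs (.loop 3 (.seq p.compile (.seq (.add i i 2) (.sub 3 b i))))
          (loopState p.eval i N s k) (loopState p.eval i N s N) t := by
      intro d
      induction d with
      | zero =>
        rintro k rfl
        exact ⟨1, by omega, .loopDone (by rw [hk3]; simp)⟩
      | succ d ihd =>
        intro k hk
        obtain ⟨t', ht', hr'⟩ := ihd (k + 1) (by omega)
        obtain ⟨t, ht, hr⟩ := ih hpr hpw (loopState p.eval i N s k) (by rw [hfr k 2 (by omega), h2])
        rw [hfr k 0 (by omega), hfr k 1 (by omega)] at ht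
        refine ⟨t + (1 + 1) + t' + 1, by rw [add_one_mul]; omega,
          .loopStep (by rw [hk3]; omega) (.seq hr (.seq (.add _ _ _ _) ?_)) hr'⟩
        have h1 : (p.eval (loopState p.eval i N s k)).reg i = k := by rw [eval_reg hip, hki]
        have h3 : (p.eval (loopState p.eval i N s k)).reg 2 = 1 := by
          rw [eval_reg (fun h => by have := hpw 2 h; omega), hfr k 2 (by omega), h2]
        have h4 : (p.eval (loopState p.eval i N s k)).reg b = N := by
          rw [eval_reg (fun h => by have := hpw b h; omega), hfr k b (by omega)]
        have := Runs.sub ((p.eval (loopState p.eval i N s k)).setReg i (k + 1)) 3 b i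
        simp only [Config.reg_setReg, show b ≠ i by omega, if_false, if_true, h4] at this
        rw [h1, h3]
        exact this
    obtain ⟨t, ht, hr⟩ := key N 0 (by omega)
    refine ⟨1 + (1 + t), ?_, .seq (.const _ _ _) (.seq (.sub _ _ _ _) ?_)⟩
    · have : (if b = 0 then s.reg 0 else s.reg 1) = N := by
        split_ifs with h
        · rw [hN, h]
        · rw [hN, show b = 1 by omega]
      rw [bound, this, ← hB]
      omega
    · have : (s.setReg i 0).reg b - (s.setReg i 0).reg i = N := by
        simp [show b ≠ i by omega, hN]
      rw [this]
      exact hr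

/-- The rule for loops: an invariant that does not depend on the loop variable. -/
theorem eval_for {b i N : ℕ} {p : Code} {s : Config} (I : ℕ → Config → Prop) (hi : 3 ≠ i)
    (hN : s.reg b = N) (h0 : I 0 s) (hinv : ∀ k s x, I k s → I k (s.setReg 3 x) ∧ I k (s.setReg i x))
    (hstep : ∀ k < N, ∀ s, I k s → s.reg i = k → I (k + 1) (p.eval s)) :
    I N ((Code.loop b i p).eval s) := by
  rw [eval, hN]
  suffices ∀ k ≤ N, I k (loopState p.eval i N s k) from this N le_rfl
  intro k hk
  induction k with
  | zero => exact (hinv _ _ _ (hinv _ _ _ h0).2).1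
  | succ k ih =>
    refine (hinv _ _ _ (hinv _ _ _ (hstep k hk _ (ih (by omega)) ?_)).2).1
    cases k <;> simp [loopState, hi.symm]

/-- `if a = b then p else q`, with `24` and `25` as auxiliary registers. -/
def ifEq (a b : ℕ) (p q : Code) : Code :=
  sub 24 a b ;; sub 25 b a ;; add 24 24 25 ;; ite 24 q p

theorem eval_ifEq {a b : ℕ} {p q : Code} {s : Config} (ha : a ≠ 24) (hb : b ≠ 24) :
    ∃ x y, (ifEq a b p q).eval s =
      if s.reg a = s.reg b then p.eval ((s.setReg 24 x).setReg 25 y)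
        else q.eval ((s.setReg 24 x).setReg 25 y) := by
  refine ⟨s.reg a - s.reg b + (s.reg b - s.reg a), s.reg b - s.reg a, ?_⟩
  have hs : ∀ x y z, ((s.setReg 24 x).setReg 25 y).setReg 24 z
      = (s.setReg 24 z).setReg 25 y := by
    intro x y z
    simp only [Config.setReg, Config.mk.injEq, and_true]
    rw [Function.update_comm (by decide), Function.update_idem]
  simp only [ifEq, eval, Config.reg_setReg, ha, hb, hs, if_true, if_false,
    show (24 : ℕ) ≠ 25 by decide]
  by_cases h : s.reg a = s.reg b
  · simp [h]
  · rw [if_neg h, if_neg (by omega)]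

end Code
end Machine

/-! ### Components that give proper `t`-convex sets -/

section Blocks
variable {V : Type*} {G : SimpleGraph V}

/-- The conditions on `M` under which its complement is a proper `t`-convex set: the neighbours of
`M` form a clique, and every vertex of `M` has at most one neighbour outside `M`. -/
structure IsBlock (G : SimpleGraph V) (M : Set V) : Prop where
  nonempty : M.Nonempty
  eq_of_adj : ∀ k ∈ M, ∀ a ∉ M, ∀ b ∉ M, G.Adj k a → G.Adj k b → a = b
  clique : ∀ a ∉ M, ∀ b ∉ M, ∀ d ∈ M, ∀ e ∈ M, G.Adj a d → G.Adj b e → a ≠ b → G.Adj a b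

theorem IsBlock.ncard_compl_mem {M : Set V} (hM : IsBlock G M) :
    Mᶜ.ncard ∈ properTConvexSizes G := by
  refine ⟨Mᶜ, tConvex_of_boundary ?_ ?_, ?_, rfl⟩
  · intro a ha b hb d hd e he
    exact hM.clique a ha b hb d (not_not.1 hd) e (not_not.1 he)
  · intro k hk a ha b hb
    exact hM.eq_of_adj k (not_not.1 hk) a ha b hb
  · obtain ⟨x, hx⟩ := hM.nonempty
    exact fun h => (h ▸ Set.mem_univ x : x ∈ Mᶜ) hx

/-- The common closed neighbourhood of two adjacent vertices. -/
def commonNbrs (G : SimpleGraph V) (u v : V) : Set V :=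
  {z | z = u ∨ z = v ∨ (G.Adj z u ∧ G.Adj z v)}

theorem commonNbrs_comm (u v : V) : commonNbrs G u v = commonNbrs G v u := by
  ext z
  simp only [commonNbrs, Set.mem_ofPred_eq]
  tauto

/-- Every proper `t`-convex set avoids a block that is a component of `G - X`, where `X` is a
single vertex or the common closed neighbourhood of the ends of an edge. -/
theorem TConvex.exists_isBlock (hG : G.Preconnected) {S : Set V} (hS : TConvex G S)
    (hne : S ≠ Set.univ) : S = ∅ ∨ ∃ X x, x ∉ X ∧
      ((∃ q, X = {q}) ∨ ∃ u v, G.Adj u v ∧ X = commonNbrs G u v) ∧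
      IsBlock G {y | RIn G Xᶜ x y} ∧ S ⊆ {y | RIn G Xᶜ x y}ᶜ := by
  obtain ⟨x, hx⟩ := (Set.ne_univ_iff_exists_notMem S).1 hne
  let K : Set V := {y | RIn G Sᶜ x y}
  have hKS : ∀ k ∈ K, k ∉ S := fun k hk => RIn.mem hk hx
  have hcl : ∀ y ∈ K, ∀ z ∉ K, G.Adj y z → z ∈ S := fun y hy z hz hyz => by
    by_contra hzS
    exact hz (ReflTransGen.tail hy ⟨hyz, hKS y hy, hzS⟩)
  have hK : IsBlock G K := by
    refine ⟨⟨x, .refl⟩, fun k hk a ha b hb hka hkb => ?_, fun a ha b hb d hd e he had hbe hab => ?_⟩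
    · exact hS.eq_of_adj (hKS k hk) (hcl k hk a ha hka) (hcl k hk b hb hkb) hka hkb
    · exact hS.adj_of_rIn (hcl d hd a ha had.symm) (hcl e he b hb hbe.symm) hab (hKS d hd) had hbe
        (RIn.symm hd |>.trans he)
  -- `K` is a component of `G - X` for every `X` that misses `K` and contains all its neighbours.
  have key : ∀ X : Set V, (∀ k ∈ K, k ∉ X) → (∀ y ∈ K, ∀ z ∉ K, G.Adj y z → z ∈ X) →
      {y | RIn G Xᶜ x y} = K := by
    intro X h1 h2
    ext y
    constructor
    · exact fun h => RIn.mem_of_closed h (show x ∈ K from .refl) fun y hy z hz hyz => by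
        by_contra hzK
        exact hz (h2 y hy z hzK hyz)
    · exact fun h => (RIn.of_closed h (show x ∈ K from .refl)
        fun y hy z hz hyz => ReflTransGen.tail hy ⟨hyz, hKS y hy, hz⟩).mono h1
  have hSK : S ⊆ Kᶜ := fun s hs hk => hKS s hk hs
  have hxK : x ∈ K := .refl
  by_cases hQ : ∃ q ∉ K, ∃ k ∈ K, G.Adj k q
  · obtain ⟨q, hq, k, hk, hkq⟩ := hQ
    have hqS := hcl k hk q hq hkq
    right
    by_cases hQ2 : ∃ r ∉ K, r ≠ q ∧ ∃ l ∈ K, G.Adj l r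
    · obtain ⟨r, hr, hrq, l, hl, hlr⟩ := hQ2
      have hrS := hcl l hl r hr hlr
      have h1 : ∀ k ∈ K, k ∉ commonNbrs G q r := by
        rintro k hk (rfl | rfl | ⟨h, h'⟩)
        · exact hq hk
        · exact hr hk
        · exact hrq (hS.eq_of_adj (hKS k hk) hrS hqS h' h)
      have h2 : ∀ y ∈ K, ∀ z ∉ K, G.Adj y z → z ∈ commonNbrs G q r := by
        intro y hy z hz hyz
        rcases eq_or_ne z q with h | hzq
        · exact .inl h
        rcases eq_or_ne z r with h | hzr
        · exact .inr (.inl h)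
        · exact .inr (.inr ⟨hK.clique z hz q hq y hy k hk hyz.symm hkq.symm hzq,
            hK.clique z hz r hr y hy l hl hyz.symm hlr.symm hzr⟩)
      refine ⟨commonNbrs G q r, x, h1 x hxK, .inr ⟨q, r, ?_, rfl⟩, ?_⟩
      · exact hK.clique q hq r hr k hk l hl hkq.symm hlr.symm hrq.symm
      · rw [key _ h1 h2]
        exact ⟨hK, hSK⟩
    · have h1 : ∀ k ∈ K, k ∉ ({q} : Set V) := by
        rintro k hk rfl
        exact hq hk
      have h2 : ∀ y ∈ K, ∀ z ∉ K, G.Adj y z → z ∈ ({q} : Set V) := by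
        intro y hy z hz hyz
        by_contra h
        exact hQ2 ⟨z, hz, h, y, hy, hyz⟩
      refine ⟨{q}, x, h1 x hxK, .inl ⟨q, rfl⟩, ?_⟩
      rw [key _ h1 h2]
      exact ⟨hK, hSK⟩
  · left
    push Not at hQ
    refine Set.eq_empty_of_forall_notMem fun s hs => ?_
    obtain ⟨p⟩ := hG x s
    refine hSK hs ((RIn.of_walk (X := Set.univ) p (by simp)).mem_of_closed hxK
      fun y hy z _ hyz => ?_)
    by_contra hz
    exact hQ z hz y hy hyz

end Blocks

/-! ### Edge lists -/

section EdgeList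
variable {n : ℕ} {G : SimpleGraph (Fin n)} {l : List (Fin n × Fin n)}

/-- `a` and `b` are the ends of an edge in the list. -/
def ListAdj (l : List (Fin n × Fin n)) (a b : Fin n) : Prop := (a, b) ∈ l ∨ (b, a) ∈ l

instance (a b : Fin n) : Decidable (ListAdj l a b) := inferInstanceAs (Decidable (_ ∨ _))

theorem listAdj_iff_mem {a b : Fin n} :
    ListAdj l a b ↔ s(a, b) ∈ l.map fun e => s(e.1, e.2) := by
  simp only [ListAdj, List.mem_map, Prod.exists, Sym2.eq_iff]
  constructor
  · rintro (h | h)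
    exacts [⟨_, _, h, .inl ⟨rfl, rfl⟩⟩, ⟨_, _, h, .inr ⟨rfl, rfl⟩⟩]
  · rintro ⟨x, y, h, ⟨rfl, rfl⟩ | ⟨rfl, rfl⟩⟩
    exacts [.inl h, .inr h]

theorem IsEdgeList.listAdj_iff (hl : IsEdgeList G l) {a b : Fin n} :
    ListAdj l a b ↔ G.Adj a b := by
  rw [listAdj_iff_mem, hl.2, SimpleGraph.mem_edgeSet]

theorem IsEdgeList.adj_getElem (hl : IsEdgeList G l) {k : ℕ} (hk : k < l.length) :
    G.Adj l[k].1 l[k].2 :=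
  hl.listAdj_iff.1 (.inl (List.getElem_mem hk))

/-- The list has no repetition as a list of unordered pairs, so a reversed copy is excluded too. -/
theorem IsEdgeList.not_listAdj_take (hl : IsEdgeList G l) {k : ℕ} (hk : k < l.length) :
    ¬ ListAdj (l.take k) l[k].1 l[k].2 := by
  rw [listAdj_iff_mem]
  have h1 : (l.take (k + 1)).map (fun e => s(e.1, e.2)) |>.Nodup := by
    rw [List.map_take]
    exact hl.1.sublist (List.take_sublist _ _)
  rw [List.take_succ_eq_append_getElem hk, List.map_append, List.nodup_append] at h1
  intro h
  exact h1.2.2 _ h _ (by simp) rfl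

theorem IsEdgeList.length_eq (hl : IsEdgeList G l) : l.length = G.edgeSet.ncard := by
  classical
  have : G.edgeSet = ((l.map fun e => s(e.1, e.2)).toFinset : Set (Sym2 (Fin n))) := by
    ext e
    rw [← hl.2]
    simp
  rw [this, Set.ncard_coe_finset, List.toFinset_card_of_nodup hl.1, List.length_map]

/-- The number of listed edges at `z` with exactly one end labelled `w`. -/
def crossCount (l : List (Fin n × Fin n)) (lab : Fin n → ℕ) (w : ℕ) (z : Fin n) : ℕ :=
  (Finset.univ.filter fun x => ListAdj l z x ∧ ¬ (lab z = w ↔ lab x = w)).card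

/-- This matches one round of the counting loop. The edge has to be new because `crossCount` counts
neighbours, while the machine counts list entries. -/
theorem crossCount_append {a b : Fin n} (hab : a ≠ b) (hnew : ¬ ListAdj l a b) (lab : Fin n → ℕ)
    (w : ℕ) (z : Fin n) :
    crossCount (l ++ [(a, b)]) lab w z = crossCount l lab w z +
      if (z = a ∨ z = b) ∧ ¬ (lab a = w ↔ lab b = w) then 1 else 0 := by
  have hnew' : ¬ ListAdj l b a := fun h => hnew (Or.symm h)
  have happ : ∀ x, ListAdj (l ++ [(a, b)]) z x ↔
      ListAdj l z x ∨ (z = a ∧ x = b) ∨ (z = b ∧ x = a) := by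
    intro x
    simp only [ListAdj, List.mem_append, List.mem_singleton, Prod.mk.injEq]
    tauto
  simp only [crossCount, happ]
  -- Here `y` is the end of the new edge opposite to `z`.
  have key : ∀ y, ¬ ListAdj l z y → (∀ x, ((z = a ∧ x = b) ∨ (z = b ∧ x = a)) ↔ x = y) →
      (Finset.univ.filter fun x => (ListAdj l z x ∨ (z = a ∧ x = b) ∨ (z = b ∧ x = a)) ∧
        ¬ (lab z = w ↔ lab x = w)).card =
      (Finset.univ.filter fun x => ListAdj l z x ∧ ¬ (lab z = w ↔ lab x = w)).card +
        if ¬ (lab z = w ↔ lab y = w) then 1 else 0 := by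
    intro y hy hxy
    simp only [hxy]
    split_ifs with hc
    · rw [add_zero]
      congr 1
      ext x
      simp only [Finset.mem_filter, Finset.mem_univ, true_and]
      constructor
      · rintro ⟨h | rfl, h'⟩
        exacts [⟨h, h'⟩, absurd hc h']
      · exact fun h => ⟨.inl h.1, h.2⟩
    · rw [← Finset.card_insert_of_notMem (a := y) (by simp [hy])]
      congr 1
      ext x
      simp only [Finset.mem_filter, Finset.mem_univ, true_and, Finset.mem_insert]
      constructor
      · rintro ⟨h | h, h'⟩
        exacts [.inr ⟨h, h'⟩, .inl h]
      · rintro (rfl | ⟨h, h'⟩)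
        exacts [⟨.inr rfl, hc⟩, ⟨.inl h, h'⟩]
  by_cases hza : z = a
  · subst hza
    rw [key b hnew fun x => by simp [hab]]
    simp
  by_cases hzb : z = b
  · subst hzb
    rw [key a hnew' fun x => by simp [hab.symm]]
    simp only [or_true, true_and, iff_comm]
  · simp [hza, hzb]

/-- The neighbours of the class of `w`. -/
def boundary (l : List (Fin n × Fin n)) (lab : Fin n → ℕ) (w : ℕ) : Finset (Fin n) :=
  Finset.univ.filter fun z => lab z ≠ w ∧ crossCount l lab w z ≠ 0

theorem crossCount_ne_zero_iff {lab : Fin n → ℕ} {w : ℕ} {z : Fin n} :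
    crossCount l lab w z ≠ 0 ↔ ∃ x, ListAdj l z x ∧ ¬ (lab z = w ↔ lab x = w) := by
  rw [crossCount, Finset.card_ne_zero, Finset.filter_nonempty_iff]
  simp

theorem IsEdgeList.mem_boundary (hl : IsEdgeList G l) {lab : Fin n → ℕ} {w : ℕ} {z : Fin n} :
    z ∈ boundary l lab w ↔ lab z ≠ w ∧ ∃ x, lab x = w ∧ G.Adj z x := by
  simp only [boundary, Finset.mem_filter, Finset.mem_univ, true_and, crossCount_ne_zero_iff,
    hl.listAdj_iff]
  refine and_congr_right fun h => exists_congr fun x => ?_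
  simp only [h, false_iff, not_not]
  exact and_comm

/-- A set of vertices is a clique if and only if it spans the maximal number of edges. -/
theorem IsEdgeList.isClique_iff (hl : IsEdgeList G l) (Q : Finset (Fin n)) :
    G.IsClique (Q : Set (Fin n)) ↔
      l.countP (fun e => decide (e.1 ∈ Q ∧ e.2 ∈ Q)) = Q.card.choose 2 := by
  classical
  set l' := l.filter fun e => decide (e.1 ∈ Q ∧ e.2 ∈ Q) with hl'
  set E := (l'.map fun e => s(e.1, e.2)).toFinset with hE
  have hcard : E.card = l.countP (fun e => decide (e.1 ∈ Q ∧ e.2 ∈ Q)) := by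
    rw [List.toFinset_card_of_nodup (hl.1.sublist (List.filter_sublist.map _)), List.length_map,
      List.countP_eq_length_filter]
  have hmem : ∀ a b, s(a, b) ∈ E ↔ a ∈ Q ∧ b ∈ Q ∧ G.Adj a b := by
    intro a b
    rw [hE, List.mem_toFinset, ← listAdj_iff_mem, ← hl.listAdj_iff]
    simp only [ListAdj, hl', List.mem_filter, decide_eq_true_eq]
    tauto
  -- The listed edges inside `Q` are among the `Q.card.choose 2` pairs, so equal cardinality means
  -- that all pairs occur.
  have hsub : E ⊆ Q.offDiag.image (Function.uncurry Sym2.mk) := by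
    intro e
    induction e using Sym2.ind with | _ a b =>
    intro h
    obtain ⟨ha, hb, hab⟩ := (hmem a b).1 h
    exact Finset.mem_image.2 ⟨(a, b), Finset.mem_offDiag.2 ⟨ha, hb, hab.ne⟩, rfl⟩
  rw [← hcard, ← Sym2.card_image_offDiag]
  constructor
  · intro hQ
    refine congrArg _ (hsub.antisymm fun e he => ?_)
    obtain ⟨⟨a, b⟩, hab, rfl⟩ := Finset.mem_image.1 he
    obtain ⟨ha, hb, hne⟩ := Finset.mem_offDiag.1 hab
    exact (hmem a b).2 ⟨ha, hb, hQ ha hb hne⟩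
  · intro h a ha b hb hne
    have := Finset.eq_of_subset_of_card_le hsub h.ge
    exact ((hmem a b).1 (this ▸ Finset.mem_image.2
      ⟨(a, b), Finset.mem_offDiag.2 ⟨ha, hb, hne⟩, rfl⟩)).2.2

/-- This replaces each condition on a block by counts that the machine can compute. -/
theorem IsEdgeList.isBlock_iff (hl : IsEdgeList G l) (lab : Fin n → ℕ) (w : ℕ) :
    IsBlock G {z | lab z = w} ↔ (∃ z, lab z = w) ∧ (∀ z, lab z = w → crossCount l lab w z ≤ 1) ∧
      l.countP (fun e => decide (e.1 ∈ boundary l lab w ∧ e.2 ∈ boundary l lab w)) =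
        (boundary l lab w).card.choose 2 := by
  rw [← hl.isClique_iff]
  have h2 : ∀ z, lab z = w → (crossCount l lab w z ≤ 1 ↔
      ∀ a, lab a ≠ w → ∀ b, lab b ≠ w → G.Adj z a → G.Adj z b → a = b) := by
    intro z hz
    rw [crossCount, Finset.card_le_one]
    simp only [Finset.mem_filter, Finset.mem_univ, true_and, hz, true_iff, hl.listAdj_iff]
    exact ⟨fun h a ha b hb ha' hb' => h a ⟨ha', ha⟩ b ⟨hb', hb⟩,
      fun h a ha b hb => h a ha.2 b hb.2 ha.1 hb.1⟩
  constructor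
  · intro h
    refine ⟨h.nonempty, fun z hz => (h2 z hz).2 (h.eq_of_adj z hz), fun a ha b hb hab => ?_⟩
    obtain ⟨ha, d, hd, had⟩ := hl.mem_boundary.1 ha
    obtain ⟨hb, e, he, hbe⟩ := hl.mem_boundary.1 hb
    exact h.clique a ha b hb d hd e he had hbe hab
  · rintro ⟨hne, hone, hcl⟩
    exact ⟨hne, fun k hk => (h2 k hk).1 (hone k hk), fun a ha b hb d hd e he had hbe hab =>
      hcl (hl.mem_boundary.2 ⟨ha, d, hd, had⟩) (hl.mem_boundary.2 ⟨hb, e, he, hbe⟩) hab⟩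

/-- The labels after the edges in `l` have been processed: the vertices outside `X` have labels
below `n`, vertices with equal labels are connected in `G - X`, and the ends of the edges of
`G - X` in `l` have equal labels. -/
structure IsLabelling (G : SimpleGraph (Fin n)) (X : Set (Fin n)) (l : List (Fin n × Fin n))
    (lab : Fin n → ℕ) : Prop where
  lt_iff : ∀ v, lab v < n ↔ v ∉ X
  rIn : ∀ a b, a ∉ X → lab a = lab b → RIn G Xᶜ a b
  eq_of_mem : ∀ e ∈ l, e.1 ∉ X → e.2 ∉ X → lab e.1 = lab e.2

theorem isLabelling_nil {X : Set (Fin n)} {lab : Fin n → ℕ} (hX : ∀ v ∈ X, lab v = n)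
    (hX' : ∀ v ∉ X, lab v = v) : IsLabelling G X [] lab := by
  have hlt : ∀ v, lab v < n ↔ v ∉ X := fun v =>
    ⟨fun h hv => by rw [hX v hv] at h; exact lt_irrefl _ h, fun h => by rw [hX' v h]; exact v.2⟩
  refine ⟨hlt, fun a b ha hab => ?_, by simp⟩
  have hb : b ∉ X := (hlt b).1 (hab ▸ (hlt a).2 ha)
  rw [hX' a ha, hX' b hb] at hab
  rw [Fin.ext hab]
  exact .refl

/-- Testing both labels against `n` discards the edges that meet `X`. Any other edge joins its two
classes, and the class of `b` takes over the label of `a`. -/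
theorem IsLabelling.append {X : Set (Fin n)} {lab : Fin n → ℕ} (h : IsLabelling G X l lab)
    {a b : Fin n} (hab : G.Adj a b) :
    IsLabelling G X (l ++ [(a, b)]) (if lab a < n ∧ lab b < n then
      fun z => if lab z = lab b then lab a else lab z else lab) := by
  split_ifs with hlt
  · obtain ⟨ha, hb⟩ := hlt
    have hstep : RIn G Xᶜ a b := .step hab ((h.lt_iff a).1 ha) ((h.lt_iff b).1 hb)
    refine ⟨fun v => ?_, fun x y hx hxy => ?_, fun e he h1 h2 => ?_⟩
    · split_ifs with hv
      · rw [← h.lt_iff, hv]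
        exact iff_of_true ha hb
      · exact h.lt_iff v
    · have hx' : ∀ z, lab z = lab b → RIn G Xᶜ a z := fun z hz =>
        hstep.trans (h.rIn b z ((h.lt_iff b).1 hb) hz.symm)
      have ha' := (h.lt_iff a).1 ha
      split_ifs at hxy with h1 h2 h2
      · exact (hx' x h1).symm.trans (hx' y h2)
      · exact (hx' x h1).symm.trans (h.rIn a y ha' hxy)
      · exact (h.rIn a x ha' hxy.symm).symm.trans (hx' y h2)
      · exact h.rIn x y hx hxy
    · rcases List.mem_append.1 he with he | he
      · simp only [h.eq_of_mem e he h1 h2]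
      · rw [List.mem_singleton] at he
        subst he
        simp
  · refine ⟨h.lt_iff, h.rIn, fun e he h1 h2 => ?_⟩
    rcases List.mem_append.1 he with he | he
    · exact h.eq_of_mem e he h1 h2
    · rw [List.mem_singleton] at he
      subst he
      exact absurd ⟨(h.lt_iff _).2 h1, (h.lt_iff _).2 h2⟩ hlt

/-- Once all edges are processed, no edge of `G - X` leaves a label class. -/
theorem IsLabelling.setOf_rIn (hl : IsEdgeList G l) {X : Set (Fin n)} {lab : Fin n → ℕ}
    (h : IsLabelling G X l lab) {x : Fin n} (hx : x ∉ X) :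
    {y | RIn G Xᶜ x y} = {y | lab y = lab x} := by
  ext y
  refine ⟨fun hy => ?_, fun hy => h.rIn x y hx hy.symm⟩
  refine RIn.mem_of_closed (Y := {y | lab y = lab x}) hy rfl fun a ha b hb hab => ?_
  have haX : a ∉ X := (h.lt_iff a).1 ((show lab a = lab x from ha) ▸ (h.lt_iff x).2 hx)
  rcases hl.listAdj_iff.2 hab with hm | hm
  · exact (h.eq_of_mem _ hm haX hb).symm.trans ha
  · exact (h.eq_of_mem _ hm hb haX).trans ha

end EdgeList

/-! ### The program and its parts -/

section Program
open Code

/-- Registers `x` and `y` receive the ends of the edge whose index is in register `j`. -/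
def edge (j x y : ℕ) : Code := add 22 j j ;; load x 22 ;; add 22 22 2 ;; load y 22

/-- Register `t` receives the label of the vertex in register `a`. -/
def getLab (t a : ℕ) : Code := add 22 4 a ;; load t 22

/-- Register `t` receives the count of the vertex in register `a`. -/
def getCnt (t a : ℕ) : Code := add 22 5 a ;; load t 22

/-- The vertex in register `a` receives the label in register `r`. -/
def setLab (a r : ℕ) : Code := add 22 4 a ;; store 22 r

/-- The count of the vertex in register `a` becomes `0`. -/
def zeroCnt (a : ℕ) : Code := add 22 5 a ;; const 23 0 ;; store 22 23

/-- The count of the vertex in register `a` increases by `1`. -/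
def bump (a : ℕ) : Code := add 22 5 a ;; load 23 22 ;; add 23 23 2 ;; store 22 23

/-- Registers `10` and `11` receive the ends of the edge whose index is in register `7`, registers
`14` and `15` their labels. -/
def loadEdge : Code := edge 7 10 11 ;; getLab 14 10 ;; getLab 15 11

/-- Counts, for every vertex, the edges at it that have one end with the label in register `9`. -/
def crossCode : Code :=
  .loop 0 8 (zeroCnt 8) ;;
  .loop 1 7 (loadEdge ;;
    ifEq 14 9 (ifEq 15 9 skip (bump 10 ;; bump 11)) (ifEq 15 9 (bump 10 ;; bump 11) skip))

/-- Merges the labels of the ends of every edge with both labels less than `n`. -/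
def mergeCode : Code :=
  .loop 1 7 (loadEdge ;; sub 26 0 14 ;; sub 27 0 15 ;;
    ite 26 (ite 27 (.loop 0 8 (getLab 23 8 ;; ifEq 23 15 (setLab 8 14) skip)) skip) skip)

/-- Computes the size of the class of the label in register `9`, whether one of its vertices has
two neighbours outside, the number of neighbours of the class, and the number of pairs of them. -/
def statCode : Code :=
  .loop 0 8 (getLab 14 8 ;; getCnt 23 8 ;;
    ifEq 14 9 (add 16 16 2 ;; sub 26 23 2 ;; ite 26 (const 17 1) skip)
      (ite 23 (add 19 19 18 ;; add 18 18 2) skip))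

/-- Computes the number of edges between neighbours of the class of the label in register `9`. -/
def pairCode : Code :=
  .loop 1 7 (loadEdge ;; getCnt 26 10 ;; getCnt 27 11 ;;
    ifEq 14 9 skip (ifEq 15 9 skip (ite 26 (ite 27 (add 20 20 2) skip) skip)))

/-- Updates register `21` if the class of the label in register `9` is a block. -/
def checkCode : Code :=
  crossCode ;; const 16 0 ;; const 17 0 ;; const 18 0 ;; const 19 0 ;; const 20 0 ;;
  statCode ;; pairCode ;;
  ifEq 19 20 (ite 17 skip (ite 16 (sub 26 0 16 ;; sub 27 26 21 ;; ite 27 (copy 21 26) skip) skip))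
    skip

/-- Finds the components of `G - X`, where `X` consists of the vertices with label `n`, and checks
them one after the other. -/
def processCode : Code := mergeCode ;; .loop 0 9 checkCode

/-- The labels for the vertex in register `6` as `X`. -/
def vertexCode : Code := .loop 0 8 (setLab 8 8) ;; setLab 6 0

/-- The labels for the common closed neighbourhood of the ends of the edge in register `6`. -/
def nbrsCode : Code :=
  edge 6 12 13 ;; const 9 0 ;; .loop 0 8 (setLab 8 2) ;; setLab 12 9 ;; setLab 13 9 ;; crossCode ;;
  .loop 0 8 (getLab 14 8 ;; getCnt 23 8 ;; sub 27 23 2 ;;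
    ite 14 (ite 27 (setLab 8 0) (setLab 8 8)) (setLab 8 0))

/-- The main part of the program. -/
def mainCode : Code :=
  add 4 1 1 ;; add 5 4 0 ;; const 21 0 ;;
  .loop 0 6 (vertexCode ;; processCode) ;; .loop 1 6 (nbrsCode ;; processCode)

/-- The program that computes the `t`-convexity number. -/
def tConvexityProg : Prog := .seq (.const 2 1) (.seq mainCode.compile (.copy 0 21))

theorem mainCode_regular : mainCode.Regular := by decide

set_option maxRecDepth 4000 in
theorem mainCode_writes : ∀ a ∈ mainCode.writes, 2 < a := by decide

/-- For a connected graph `n ≤ m + 1`. If `m = 0`, this leaves only `n = 1`; otherwise `n ≤ 2 * m`,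
which bounds every monomial in the running time by a multiple of `n * m ^ 2`. The constant is
generous. -/
theorem bound_mainCode {n m : ℕ} (hn : 0 < n) (h : n ≤ m + 1) :
    mainCode.bound n m + 2 ≤ 10000 * (n * m ^ 2 + 1) := by
  simp only [mainCode, vertexCode, nbrsCode, processCode, checkCode, pairCode, statCode, mergeCode,
    crossCode, loadEdge, bump, zeroCnt, setLab, getCnt, getLab, edge, ifEq, Code.bound, if_true,
    show (1 : ℕ) ≠ 0 by decide, if_false]
  rcases Nat.eq_zero_or_pos m with rfl | hm
  · obtain rfl : n = 1 := by omega
    norm_num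
  · have h2 : n ≤ 2 * m := by omega
    have e1 : 1 ≤ n * m ^ 2 := Nat.mul_pos hn (pow_pos hm 2)
    have e2 : n * m ≤ n * m ^ 2 := Nat.mul_le_mul_left n (Nat.le_self_pow (by decide) m)
    have e3 : n ≤ n * m ^ 2 := Nat.le_mul_of_pos_right n (pow_pos hm 2)
    have e4 : m ^ 2 ≤ n * m ^ 2 := Nat.le_mul_of_pos_left _ hn
    have e5 : m ≤ n * m ^ 2 := (Nat.le_self_pow (by decide) m).trans e4
    have e6 : n * n ≤ n * (2 * m) := Nat.mul_le_mul_left n h2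
    have e7 : n * n * m ≤ n * (2 * m) * m := Nat.mul_le_mul_right m e6
    have e8 : n * n * n ≤ n * n * (2 * m) := Nat.mul_le_mul_left _ h2
    ring_nf at *
    omega

end Program

/-! ### The representation of labels and counts in the memory -/

section Spec
open Code
variable {n : ℕ} {G : SimpleGraph (Fin n)} {l : List (Fin n × Fin n)} {s : Config}
  {lab cnt : Fin n → ℕ} {best : ℕ}

/-- The memory of `s` holds the edges in `l`, the labels and the counts of the vertices, and `best`
is the best value found so far. -/
structure Holds (l : List (Fin n × Fin n)) (s : Config) (lab cnt : Fin n → ℕ) (best : ℕ) :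
    Prop where
  reg0 : s.reg 0 = n
  reg1 : s.reg 1 = l.length
  reg2 : s.reg 2 = 1
  reg4 : s.reg 4 = 2 * l.length
  reg5 : s.reg 5 = 2 * l.length + n
  reg21 : s.reg 21 = best
  fst : ∀ (k : ℕ) (h : k < l.length), s.mem (k + k) = l[k].1
  snd : ∀ (k : ℕ) (h : k < l.length), s.mem (k + k + 1) = l[k].2
  lab : ∀ v : Fin n, s.mem (2 * l.length + v) = lab v
  cnt : ∀ v : Fin n, s.mem (2 * l.length + n + v) = cnt v

theorem Holds.setReg (h : Holds l s lab cnt best) {a : ℕ} (ha : a ∉ [0, 1, 2, 4, 5, 21])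
    (x : ℕ) : Holds l (s.setReg a x) lab cnt best := by
  simp only [List.mem_cons, List.not_mem_nil, or_false, not_or] at ha
  obtain ⟨h0, h1, h2, h4, h5, h21⟩ := ha
  constructor <;> simp only [Config.reg_setReg, Config.mem_setReg, Ne.symm h0, Ne.symm h1,
    Ne.symm h2, Ne.symm h4, Ne.symm h5, Ne.symm h21, if_false]
  exacts [h.reg0, h.reg1, h.reg2, h.reg4, h.reg5, h.reg21, h.fst, h.snd, h.lab, h.cnt]

theorem Holds.setBest (h : Holds l s lab cnt best) (x : ℕ) :
    Holds l (s.setReg 21 x) lab cnt x := by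
  constructor <;> simp only [Config.reg_setReg, Config.mem_setReg]
  exacts [h.reg0, h.reg1, h.reg2, h.reg4, h.reg5, rfl, h.fst, h.snd, h.lab, h.cnt]

theorem Holds.storeLab (h : Holds l s lab cnt best) (v : Fin n) (x : ℕ) :
    Holds l (s.setMem (2 * l.length + v) x) (Function.update lab v x) cnt best := by
  refine ⟨h.reg0, h.reg1, h.reg2, h.reg4, h.reg5, h.reg21, fun k hk => ?_, fun k hk => ?_,
    fun w => ?_, fun w => ?_⟩
  · rw [Config.mem_setMem, if_neg (by omega), h.fst k hk]
  · rw [Config.mem_setMem, if_neg (by omega), h.snd k hk]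
  · rw [Config.mem_setMem, Function.update_apply, h.lab]
    simp only [Nat.add_left_cancel_iff, Fin.val_inj]
  · rw [Config.mem_setMem, if_neg (by omega), h.cnt]

theorem Holds.storeCnt (h : Holds l s lab cnt best) (v : Fin n) (x : ℕ) :
    Holds l (s.setMem (2 * l.length + n + v) x) lab (Function.update cnt v x) best := by
  refine ⟨h.reg0, h.reg1, h.reg2, h.reg4, h.reg5, h.reg21, fun k hk => ?_, fun k hk => ?_,
    fun w => ?_, fun w => ?_⟩
  · rw [Config.mem_setMem, if_neg (by omega), h.fst k hk]
  · rw [Config.mem_setMem, if_neg (by omega), h.snd k hk]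
  · rw [Config.mem_setMem, if_neg (by omega), h.lab]
  · rw [Config.mem_setMem, Function.update_apply, h.cnt]
    simp only [Nat.add_left_cancel_iff, Fin.val_inj]

theorem eval_seq (p q : Code) : (p ;; q).eval s = q.eval (p.eval s) := rfl

theorem ifEq_induction {Q : Config → Prop} {a b : ℕ} {p q : Code} (ha : a ≠ 24) (hb : b ≠ 24)
    (hp : s.reg a = s.reg b → ∀ x y, Q (p.eval ((s.setReg 24 x).setReg 25 y)))
    (hq : s.reg a ≠ s.reg b → ∀ x y, Q (q.eval ((s.setReg 24 x).setReg 25 y))) :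
    Q ((ifEq a b p q).eval s) := by
  obtain ⟨x, y, h⟩ := eval_ifEq (p := p) (q := q) (s := s) ha hb
  rw [h]
  split_ifs with hab
  exacts [hp hab x y, hq hab x y]

theorem Holds.eval_edge (h : Holds l s lab cnt best) {j x y k : ℕ} (hk : k < l.length)
    (hj : s.reg j = k) (hx : x ∉ [0, 1, 2, 4, 5, 21, 22]) (hy : y ∉ [0, 1, 2, 4, 5, 21])
    (hxy : x ≠ y) :
    Holds l ((edge j x y).eval s) lab cnt best ∧ ((edge j x y).eval s).reg x = l[k].1 ∧
      ((edge j x y).eval s).reg y = l[k].2 := by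
  simp only [List.mem_cons, List.not_mem_nil, or_false, not_or] at hx
  simp only [edge, Code.eval]
  refine ⟨(((h.setReg (by decide) _).setReg (by simp [hx]) _).setReg (by decide) _).setReg hy _,
    ?_, ?_⟩
  · simp [hx, hxy, hj, h.fst k hk]
  · simp [Ne.symm hx.2.2.1, Ne.symm hx.2.2.2.2.2.2, hj, h.reg2, h.snd k hk]

theorem Holds.eval_getLab (h : Holds l s lab cnt best) {t a : ℕ} {v : Fin n} (ha : s.reg a = v)
    (ht : t ∉ [0, 1, 2, 4, 5, 21]) : Holds l ((getLab t a).eval s) lab cnt best ∧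
      ((getLab t a).eval s).reg t = lab v := by
  simp only [getLab, Code.eval]
  exact ⟨(h.setReg (by decide) _).setReg ht _, by simp [ha, h.reg4, h.lab]⟩

theorem Holds.eval_getCnt (h : Holds l s lab cnt best) {t a : ℕ} {v : Fin n} (ha : s.reg a = v)
    (ht : t ∉ [0, 1, 2, 4, 5, 21]) : Holds l ((getCnt t a).eval s) lab cnt best ∧
      ((getCnt t a).eval s).reg t = cnt v := by
  simp only [getCnt, Code.eval]
  exact ⟨(h.setReg (by decide) _).setReg ht _, by simp [ha, h.reg5, h.cnt]⟩

theorem Holds.eval_setLab (h : Holds l s lab cnt best) {a r x : ℕ} {v : Fin n} (ha : s.reg a = v)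
    (hx : s.reg r = x) (hr : r ≠ 22) :
    Holds l ((setLab a r).eval s) (Function.update lab v x) cnt best := by
  simp only [setLab, Code.eval, Config.reg_setReg, if_true, hr, if_false, h.reg4, ha,
    hx]
  exact (h.setReg (by decide) _).storeLab v x

theorem Holds.eval_zeroCnt (h : Holds l s lab cnt best) {a : ℕ} {v : Fin n} (ha : s.reg a = v) :
    Holds l ((zeroCnt a).eval s) lab (Function.update cnt v 0) best := by
  have := ((h.setReg (a := 22) (by decide) (2 * l.length + n + v)).setReg (a := 23) (by decide)
    0).storeCnt v 0
  simpa [zeroCnt, Code.eval, h.reg5, ha] using this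

theorem Holds.eval_bump (h : Holds l s lab cnt best) {a : ℕ} {v : Fin n} (ha : s.reg a = v) :
    Holds l ((bump a).eval s) lab (Function.update cnt v (cnt v + 1)) best := by
  simp only [bump, Code.eval]
  have := (((h.setReg (a := 22) (by decide) (2 * l.length + n + v)).setReg (a := 23) (by decide)
    (cnt v)).setReg (a := 23) (by decide) (cnt v + 1)).storeCnt v (cnt v + 1)
  simpa [h.reg5, h.reg2, ha, h.cnt] using this

/-- A loop that changes the label of every vertex. -/
theorem Holds.forLab (h : Holds l s lab cnt best) (g : Fin n → ℕ) {p : Code}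
    (P : Config → Prop) (hP : P s) (hinv : ∀ s x, P s → P (s.setReg 3 x) ∧ P (s.setReg 8 x))
    (hstep : ∀ (z : Fin n) (s : Config) (lab' : Fin n → ℕ), P s → Holds l s lab' cnt best →
      s.reg 8 = z → lab' z = lab z →
        P (p.eval s) ∧ Holds l (p.eval s) (Function.update lab' z (g z)) cnt best) :
    P ((Code.loop 0 8 p).eval s) ∧ Holds l ((Code.loop 0 8 p).eval s) g cnt best := by
  obtain ⟨h1, lab', h2, h3, -⟩ := eval_for (b := 0) (i := 8) (p := p) (s := s)
    (fun k s => P s ∧ ∃ lab', Holds l s lab' cnt best ∧ (∀ v : Fin n, v.val < k → lab' v = g v) ∧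
      ∀ v : Fin n, k ≤ v.val → lab' v = lab v) (by decide) h.reg0
    ⟨hP, lab, h, by simp, by simp⟩
    (fun k s x ⟨h1, lab', h2, h3⟩ => ⟨⟨(hinv s x h1).1, lab', h2.setReg (by decide) x, h3⟩,
      ⟨(hinv s x h1).2, lab', h2.setReg (by decide) x, h3⟩⟩)
    (fun k hk s ⟨h1, lab', h2, h3, h4⟩ hs => by
      obtain ⟨h5, h6⟩ := hstep ⟨k, hk⟩ s lab' h1 h2 hs (h4 _ le_rfl)
      refine ⟨h5, _, h6, fun v hv => ?_, fun v hv => ?_⟩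
      · rw [Function.update_apply]
        split_ifs with hvk
        · rw [hvk]
        · exact h3 v (lt_of_le_of_ne (Nat.lt_succ_iff.1 hv) fun h => hvk (Fin.ext h))
      · rw [Function.update_of_ne (fun h => by rw [h] at hv; simp at hv), h4 v (by omega)])
  refine ⟨h1, ?_⟩
  rwa [show lab' = g from funext fun v => h3 v v.2] at h2

theorem Holds.forZeroCnt (h : Holds l s lab cnt best) :
    Holds l ((Code.loop 0 8 (zeroCnt 8)).eval s) lab (fun _ => 0) best := by
  obtain ⟨cnt', h2, h3⟩ := eval_for (b := 0) (i := 8) (p := zeroCnt 8) (s := s)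
    (fun k s => ∃ cnt', Holds l s lab cnt' best ∧ ∀ v : Fin n, v.val < k → cnt' v = 0)
    (by decide) h.reg0 ⟨cnt, h, by simp⟩
    (fun k s x ⟨cnt', h2, h3⟩ => ⟨⟨cnt', h2.setReg (by decide) x, h3⟩,
      ⟨cnt', h2.setReg (by decide) x, h3⟩⟩)
    (fun k hk s ⟨cnt', h2, h3⟩ hs => by
      refine ⟨_, h2.eval_zeroCnt (v := ⟨k, hk⟩) hs, fun v hv => ?_⟩
      rw [Function.update_apply]
      split_ifs with hvk
      · rfl
      · exact h3 v (lt_of_le_of_ne (Nat.lt_succ_iff.1 hv) fun h => hvk (Fin.ext h)))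
  rwa [show cnt' = fun _ => 0 from funext fun v => h3 v v.2] at h2

theorem Holds.eval_loadEdge (h : Holds l s lab cnt best) {k : ℕ} (hk : k < l.length)
    (hs : s.reg 7 = k) :
    Holds l (loadEdge.eval s) lab cnt best ∧ (loadEdge.eval s).reg 10 = l[k].1 ∧
      (loadEdge.eval s).reg 11 = l[k].2 ∧ (loadEdge.eval s).reg 14 = lab l[k].1 ∧
      (loadEdge.eval s).reg 15 = lab l[k].2 := by
  obtain ⟨h1, e1, e2⟩ := h.eval_edge hk hs (x := 10) (y := 11) (by decide) (by decide) (by decide)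
  obtain ⟨h2, e3⟩ := h1.eval_getLab (t := 14) e1 (by decide)
  have e2' : ((getLab 14 10).eval ((edge 7 10 11).eval s)).reg 11 = l[k].2 := by
    rw [eval_reg (by decide), e2]
  obtain ⟨h3, e4⟩ := h2.eval_getLab (t := 15) e2' (by decide)
  refine ⟨h3, ?_, ?_, ?_, e4⟩
  · rw [loadEdge, eval_seq, eval_seq, eval_reg (by decide), eval_reg (by decide), e1]
  · rw [loadEdge, eval_seq, eval_seq, eval_reg (by decide), e2']
  · rw [loadEdge, eval_seq, eval_seq, eval_reg (by decide), e3]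

/-- The auxiliary registers of a comparison do not matter. -/
theorem Holds.setReg_ifEq (h : Holds l s lab cnt best) (x y : ℕ) :
    Holds l ((s.setReg 24 x).setReg 25 y) lab cnt best :=
  (h.setReg (by decide) x).setReg (by decide) y

theorem eval_ite (a : ℕ) (p q : Code) :
    (ite a p q).eval s = if s.reg a = 0 then q.eval s else p.eval s := rfl

theorem eval_sub (a b c : ℕ) : (sub a b c).eval s = s.setReg a (s.reg b - s.reg c) := rfl

theorem eval_add (a b c : ℕ) : (add a b c).eval s = s.setReg a (s.reg b + s.reg c) := rfl

theorem eval_const (a k : ℕ) : (const a k).eval s = s.setReg a k := rfl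

theorem eval_skip : skip.eval s = s := rfl

theorem holds_ifEq {a b : ℕ} {p q : Code} (ha : a ≠ 24) (hb : b ≠ 24)
    (hp : s.reg a = s.reg b → ∀ x y, Holds l (p.eval ((s.setReg 24 x).setReg 25 y)) lab cnt best)
    (hq : s.reg a ≠ s.reg b → ∀ x y, Holds l (q.eval ((s.setReg 24 x).setReg 25 y)) lab cnt best) :
    Holds l ((ifEq a b p q).eval s) lab cnt best :=
  ifEq_induction (Q := fun s => Holds l s lab cnt best) ha hb hp hq

theorem Holds.eval_bump_bump (h : Holds l s lab cnt best) {a b : Fin n} (hab : a ≠ b)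
    (ha : s.reg 10 = a) (hb : s.reg 11 = b) :
    Holds l ((bump 10 ;; bump 11).eval s) lab (fun z => cnt z + if z = a ∨ z = b then 1 else 0)
      best := by
  have h1 := (h.eval_bump ha).eval_bump (a := 11) (v := b) (by rw [eval_reg (by decide), hb])
  rw [eval_seq]
  convert h1 using 1
  funext z
  simp only [Function.update_apply, hab.symm, if_false]
  by_cases hzb : z = b
  · subst hzb
    simp
  · by_cases hza : z = a <;> simp [hza, hzb]
    simp [← hza, hzb]

theorem Holds.eval_crossCode (hl : IsEdgeList G l) (h : Holds l s lab cnt best) {w : ℕ}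
    (hw : s.reg 9 = w) : Holds l (crossCode.eval s) lab (crossCount l lab w) best := by
  have h0 := h.forZeroCnt
  -- Invariant: after `k` rounds the counts are those of the first `k` edges.
  have key := eval_for (b := 1) (i := 7)
    (p := loadEdge ;; ifEq 14 9 (ifEq 15 9 skip (bump 10 ;; bump 11))
      (ifEq 15 9 (bump 10 ;; bump 11) skip))
    (fun k s => s.reg 9 = w ∧ Holds l s lab (crossCount (l.take k) lab w) best) (by decide) h0.reg1
    ⟨by rw [eval_reg (by decide), hw], by
      rwa [show crossCount (l.take 0) lab w = fun _ => 0 from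
        funext fun z => by simp [crossCount, ListAdj]]⟩
    (fun k s x ⟨h1, h2⟩ => ⟨⟨by simpa using h1, h2.setReg (by decide) x⟩,
      ⟨by simpa using h1, h2.setReg (by decide) x⟩⟩)
    (fun k hk s ⟨hw, h⟩ hs => by
      refine ⟨by rw [eval_reg (by decide), hw], ?_⟩
      obtain ⟨h1, e10, e11, e14, e15⟩ := h.eval_loadEdge hk hs
      have e9 : (loadEdge.eval s).reg 9 = w := by rw [eval_reg (by decide), hw]
      rw [eval_seq]
      generalize loadEdge.eval s = s at *
      have hcount := crossCount_append (hl.adj_getElem hk).ne (hl.not_listAdj_take hk) lab w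
      rw [List.take_succ_eq_append_getElem hk]
      have hsame : (lab l[k].1 = w ↔ lab l[k].2 = w) →
          crossCount (l.take k ++ [l[k]]) lab w = crossCount (l.take k) lab w := fun h =>
        funext fun z => by rw [hcount]; simp [h]
      have hdiff : ¬ (lab l[k].1 = w ↔ lab l[k].2 = w) →
          crossCount (l.take k ++ [l[k]]) lab w =
            fun z => crossCount (l.take k) lab w z + if z = l[k].1 ∨ z = l[k].2 then 1 else 0 :=
        fun h => funext fun z => by rw [hcount]; simp [h]
      have hb : ∀ x y x' y', ¬ (lab l[k].1 = w ↔ lab l[k].2 = w) →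
          Holds l ((bump 10 ;; bump 11).eval
            ((((s.setReg 24 x).setReg 25 y).setReg 24 x').setReg 25 y')) lab
            (crossCount (l.take k ++ [l[k]]) lab w) best := fun x y x' y' h => by
        rw [hdiff h]
        exact ((h1.setReg_ifEq x y).setReg_ifEq x' y').eval_bump_bump (hl.adj_getElem hk).ne
          (by simpa using e10) (by simpa using e11)
      refine holds_ifEq (by decide) (by decide) (fun c1 x y => ?_) fun c1 x y => ?_ <;>
      · rw [e14, e9] at c1
        refine holds_ifEq (by decide) (by decide) (fun c2 x' y' => ?_) fun c2 x' y' => ?_ <;>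
        · simp only [Config.reg_setReg, e15, e9, reduceIte, Nat.reduceEqDiff] at c2
          first
          | exact hb x y x' y' (by tauto)
          | rw [hsame (by tauto)]
            exact (h1.setReg_ifEq x y).setReg_ifEq x' y')
  rw [List.take_length] at key
  exact key.2

theorem Holds.eval_mergeCode (hl : IsEdgeList G l) (h : Holds l s lab cnt best) {X : Set (Fin n)}
    (hX : IsLabelling G X [] lab) :
    ∃ lab', Holds l (mergeCode.eval s) lab' cnt best ∧ IsLabelling G X l lab' := by
  have key := eval_for (b := 1) (i := 7)
    (p := loadEdge ;; sub 26 0 14 ;; sub 27 0 15 ;;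
      ite 26 (ite 27 (.loop 0 8 (getLab 23 8 ;; ifEq 23 15 (setLab 8 14) skip)) skip) skip)
    (fun k s => ∃ lab', Holds l s lab' cnt best ∧ IsLabelling G X (l.take k) lab') (by decide)
    h.reg1 ⟨lab, h, hX⟩
    (fun k s x ⟨lab', h1, h2⟩ => ⟨⟨lab', h1.setReg (by decide) x, h2⟩,
      ⟨lab', h1.setReg (by decide) x, h2⟩⟩)
    (fun k hk s ⟨lab', h, hlab⟩ hs => by
      obtain ⟨h1, e10, e11, e14, e15⟩ := h.eval_loadEdge hk hs
      rw [eval_seq]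
      generalize loadEdge.eval s = s at *
      refine ⟨_, ?_, List.take_succ_eq_append_getElem hk ▸ hlab.append (hl.adj_getElem hk)⟩
      have h2 : ∀ x y, Holds l ((s.setReg 26 x).setReg 27 y) lab' cnt best := fun x y =>
        (h1.setReg (by decide) x).setReg (by decide) y
      rw [eval_seq, eval_seq, eval_sub, eval_sub, eval_ite, eval_ite, eval_skip]
      simp only [Config.reg_setReg, reduceIte, Nat.reduceEqDiff, h1.reg0, e14, e15]
      have h3 := h2 (n - lab' l[k].1) (n - lab' l[k].2)
      split_ifs with c1 c2 c2 c2 c2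
      · omega
      · exact h3
      · omega
      · exact h3
      · generalize hs' : (s.setReg 26 (n - lab' l[k].1)).setReg 27 (n - lab' l[k].2) = s' at *
        -- The two labels are kept in registers `14` and `15`, so the comparisons use the old values
        -- even after the ends of the edge have been relabelled.
        refine (h3.forLab _ (fun s => s.reg 14 = lab' l[k].1 ∧ s.reg 15 = lab' l[k].2)
          (by simp [← hs', e14, e15]) (fun s x h => by simpa using h)
          fun z s lab'' ⟨e14, e15⟩ h hz hlz => ⟨?_, ?_⟩).2
        · rw [eval_reg (by decide), eval_reg (by decide)]
          exact ⟨e14, e15⟩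
        · obtain ⟨h', e23⟩ := h.eval_getLab (t := 23) hz (by decide)
          have e15' : ((getLab 23 8).eval s).reg 15 = lab' l[k].2 := by
            rw [eval_reg (by decide), e15]
          have e14' : ((getLab 23 8).eval s).reg 14 = lab' l[k].1 := by
            rw [eval_reg (by decide), e14]
          have e8' : ((getLab 23 8).eval s).reg 8 = z := by
            rw [eval_reg (by decide), hz]
          rw [eval_seq]
          generalize (getLab 23 8).eval s = s at *
          refine holds_ifEq (by decide) (by decide) (fun c x y => ?_) fun c x y => ?_
          · rw [e23, e15', hlz] at c
            rw [if_pos c]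
            exact (h'.setReg_ifEq x y).eval_setLab (by simpa using e8') (by simpa using e14')
              (by decide)
          · rw [e23, e15', hlz] at c
            rw [if_neg c, ← hlz, Function.update_eq_self]
            exact h'.setReg_ifEq x y
      · omega)
  rw [List.take_length] at key
  exact key

/-- The number of vertices below `k` with the property `P`. -/
def prefixCard (k : ℕ) (P : Fin n → Prop) [DecidablePred P] : ℕ :=
  (Finset.univ.filter fun z : Fin n => z.val < k ∧ P z).card

theorem prefixCard_succ (P : Fin n → Prop) [DecidablePred P] (z : Fin n) :
    prefixCard (z + 1) P = prefixCard z P + if P z then 1 else 0 := by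
  rw [prefixCard, prefixCard]
  split_ifs with h
  · rw [← Finset.card_insert_of_notMem (a := z) (by simp)]
    congr 1
    ext x
    simp only [Finset.mem_filter, Finset.mem_univ, true_and, Finset.mem_insert,
      Nat.lt_succ_iff_lt_or_eq, Fin.val_inj]
    constructor
    · rintro ⟨h1 | rfl, h2⟩
      exacts [.inr ⟨h1, h2⟩, .inl rfl]
    · rintro (rfl | ⟨h1, h2⟩)
      exacts [⟨.inr rfl, h⟩, ⟨.inl h1, h2⟩]
  · rw [add_zero]
    congr 1
    ext x
    simp only [Finset.mem_filter, Finset.mem_univ, true_and, Nat.lt_succ_iff_lt_or_eq, Fin.val_inj]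
    constructor
    · rintro ⟨h1 | rfl, h2⟩
      exacts [⟨h1, h2⟩, absurd h2 h]
    · exact fun h => ⟨.inl h.1, h.2⟩

/-- The contents of the registers `16` to `19` after the first `k` vertices. -/
structure Stats (s : Config) (lab cnt : Fin n → ℕ) (w k : ℕ) : Prop where
  label : s.reg 9 = w
  size : s.reg 16 = prefixCard k fun z => lab z = w
  bad : s.reg 17 = 0 ↔ ∀ z : Fin n, z.val < k → lab z = w → cnt z ≤ 1
  nbrs : s.reg 18 = prefixCard k fun z => lab z ≠ w ∧ cnt z ≠ 0
  pairs : s.reg 19 = (s.reg 18).choose 2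

theorem Stats.setReg {w k : ℕ} (h : Stats s lab cnt w k) {a : ℕ} (ha : a ∉ [9, 16, 17, 18, 19])
    (x : ℕ) : Stats (s.setReg a x) lab cnt w k := by
  simp only [List.mem_cons, List.not_mem_nil, or_false, not_or] at ha
  obtain ⟨h0, h1, h2, h4, h5⟩ := ha
  constructor <;> simp only [Config.reg_setReg, Ne.symm h0, Ne.symm h1,
    Ne.symm h2, Ne.symm h4, Ne.symm h5, if_false]
  exacts [h.label, h.size, h.bad, h.nbrs, h.pairs]

theorem Stats.congr {w k : ℕ} {s' : Config} (h : Stats s lab cnt w k)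
    (hs : ∀ a ∈ [9, 16, 17, 18, 19], s'.reg a = s.reg a) : Stats s' lab cnt w k := by
  simp only [List.mem_cons, List.not_mem_nil, or_false, forall_eq_or_imp, forall_eq] at hs
  obtain ⟨h0, h1, h2, h3, h4⟩ := hs
  exact ⟨h0 ▸ h.label, h1 ▸ h.size, h2 ▸ h.bad, h3 ▸ h.nbrs, by rw [h4, h3, h.pairs]⟩

theorem Stats.succ_of_eq {w : ℕ} {s' : Config} {z : Fin n} (h : Stats s lab cnt w z)
    (hz : lab z = w) (h9 : s'.reg 9 = s.reg 9) (h16 : s'.reg 16 = s.reg 16 + 1)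
    (h17 : s'.reg 17 = 0 ↔ s.reg 17 = 0 ∧ cnt z ≤ 1) (h18 : s'.reg 18 = s.reg 18)
    (h19 : s'.reg 19 = s.reg 19) : Stats s' lab cnt w (z + 1) := by
  refine ⟨h9.trans h.label, ?_, ?_, ?_, by rw [h19, h18, h.pairs]⟩
  · rw [h16, prefixCard_succ, if_pos hz, h.size]
  · rw [h17, h.bad]
    constructor
    · rintro ⟨h1, h2⟩ v hv hvw
      rcases Nat.lt_succ_iff_lt_or_eq.1 hv with hv | hv
      · exact h1 v hv hvw
      · rwa [Fin.ext hv]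
    · exact fun h1 => ⟨fun v hv => h1 v (by omega), h1 z (by omega) hz⟩
  · rw [h18, prefixCard_succ, if_neg (fun h => h.1 hz), h.nbrs]
    rfl

theorem Stats.succ_of_ne {w : ℕ} {s' : Config} {z : Fin n} (h : Stats s lab cnt w z)
    (hz : lab z ≠ w) (h9 : s'.reg 9 = s.reg 9) (h16 : s'.reg 16 = s.reg 16)
    (h17 : s'.reg 17 = s.reg 17) (h18 : s'.reg 18 = s.reg 18 + if cnt z ≠ 0 then 1 else 0)
    (h19 : s'.reg 19 = s.reg 19 + if cnt z ≠ 0 then s.reg 18 else 0) :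
    Stats s' lab cnt w (z + 1) := by
  refine ⟨h9.trans h.label, ?_, ?_, ?_, ?_⟩
  · rw [h16, prefixCard_succ, if_neg hz, h.size]
    rfl
  · rw [h17, h.bad]
    refine forall_congr' fun v => ⟨fun h1 hv hvw => h1 ?_ hvw, fun h1 hv => h1 (by omega)⟩
    refine lt_of_le_of_ne (Nat.lt_succ_iff.1 hv) fun h => hz ?_
    rwa [← Fin.ext h]
  · rw [h18, prefixCard_succ, h.nbrs]
    simp only [ne_eq, hz, not_false_eq_true, true_and]
  · rw [h18, h19, h.pairs]
    split_ifs
    -- Each new neighbour forms a pair with all earlier ones; this is why the program adds register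
    -- `18` to `19` before incrementing `18`.
    · rw [Nat.choose_succ_succ' _ 1, Nat.choose_one_right, add_comm]
    · rfl

theorem Holds.eval_statCode (h : Holds l s lab cnt best) {w : ℕ} (h9 : s.reg 9 = w)
    (h16 : s.reg 16 = 0) (h17 : s.reg 17 = 0) (h18 : s.reg 18 = 0) (h19 : s.reg 19 = 0) :
    Holds l (statCode.eval s) lab cnt best ∧ Stats (statCode.eval s) lab cnt w n := by
  refine eval_for (fun k s => Holds l s lab cnt best ∧ Stats s lab cnt w k) (by decide) h.reg0
    ⟨h, ⟨h9, by simp [h16, prefixCard], by simp [h17], by simp [h18, prefixCard],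
      by simp [h18, h19]⟩⟩
    (fun k s x ⟨h1, h2⟩ => ⟨⟨h1.setReg (by decide) x, h2.setReg (by decide) x⟩,
      ⟨h1.setReg (by decide) x, h2.setReg (by decide) x⟩⟩)
    (fun k hk s ⟨h, hst⟩ hs => ?_)
  have hz : s.reg 8 = (⟨k, hk⟩ : Fin n) := hs
  have hst' : Stats s lab cnt w (⟨k, hk⟩ : Fin n) := hst
  change _ ∧ Stats _ lab cnt w ((⟨k, hk⟩ : Fin n) + 1)
  generalize (⟨k, hk⟩ : Fin n) = z at *
  clear hst hs
  rw [eval_seq, eval_seq]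
  obtain ⟨h1, e14⟩ := h.eval_getLab (t := 14) hz (by decide)
  obtain ⟨h2, e23⟩ := h1.eval_getCnt (t := 23) (a := 8) (v := z)
    (by rw [eval_reg (by decide), hz]) (by decide)
  have hst2 : Stats ((getCnt 23 8).eval ((getLab 14 8).eval s)) lab cnt w z :=
    hst'.congr fun a ha => by
      rw [eval_reg (by revert a; decide), eval_reg (by revert a; decide)]
  have e14' : ((getCnt 23 8).eval ((getLab 14 8).eval s)).reg 14 = lab z := by
    rw [eval_reg (by decide), e14]
  generalize (getCnt 23 8).eval ((getLab 14 8).eval s) = s at *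
  clear h1 e14 h hst' hz
  have e9 := hst2.label
  have e2 := h2.reg2
  refine ifEq_induction (Q := fun s => Holds l s lab cnt best ∧ Stats s lab cnt w (z + 1))
        (by decide) (by decide) (fun c x y => ?_) fun c x y => ?_
  · rw [e14', e9] at c
    have h3 := h2.setReg_ifEq x y
    rw [eval_seq, eval_seq, eval_add, eval_sub, eval_ite, eval_const, eval_skip]
    split_ifs with c'
    · refine ⟨(h3.setReg (by decide) _).setReg (by decide) _, hst2.succ_of_eq c ?_ ?_ ?_ ?_ ?_⟩
      all_goals simp [e2]
      simp [e2, e23] at c'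
      exact fun _ => by omega
    · refine ⟨((h3.setReg (by decide) _).setReg (by decide) _).setReg (by decide) _,
        hst2.succ_of_eq c ?_ ?_ ?_ ?_ ?_⟩
      all_goals simp [e2]
      simp [e2, e23] at c'
      omega
  · rw [e14', e9] at c
    have h3 := h2.setReg_ifEq x y
    rw [eval_ite, eval_seq, eval_add, eval_add, eval_skip]
    split_ifs with c'
    · refine ⟨h3, hst2.succ_of_ne c ?_ ?_ ?_ ?_ ?_⟩
      all_goals simp [e23] at c' ⊢
      all_goals simp [c']
    · refine ⟨(h3.setReg (by decide) _).setReg (by decide) _, hst2.succ_of_ne c ?_ ?_ ?_ ?_ ?_⟩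
      all_goals simp [e23] at c' ⊢
      all_goals simp [c', e2]

/-- A vertex is in the boundary exactly if its label is not `w` and its count is nonzero, so four
tests on stored values decide whether an edge is counted. -/
theorem Holds.eval_pairCode {w : ℕ} (h : Holds l s lab (crossCount l lab w) best)
    (h9 : s.reg 9 = w) (h20 : s.reg 20 = 0) :
    Holds l (pairCode.eval s) lab (crossCount l lab w) best ∧ (pairCode.eval s).reg 20 =
      l.countP fun e => decide (e.1 ∈ boundary l lab w ∧ e.2 ∈ boundary l lab w) := by
  have key := eval_for (b := 1) (i := 7)
    (p := loadEdge ;; getCnt 26 10 ;; getCnt 27 11 ;;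
      ifEq 14 9 skip (ifEq 15 9 skip (ite 26 (ite 27 (add 20 20 2) skip) skip)))
    (fun k s => s.reg 9 = w ∧ Holds l s lab (crossCount l lab w) best ∧ s.reg 20 =
      (l.take k).countP fun e => decide (e.1 ∈ boundary l lab w ∧ e.2 ∈ boundary l lab w))
    (by decide) h.reg1 ⟨h9, h, by simpa using h20⟩
    (fun k s x ⟨h1, h2, h3⟩ => ⟨⟨by simpa using h1, h2.setReg (by decide) x, by simpa using h3⟩,
      ⟨by simpa using h1, h2.setReg (by decide) x, by simpa using h3⟩⟩)
    (fun k hk s ⟨h9, h, h20⟩ hs => by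
      refine ⟨by rw [eval_reg (by decide), h9], ?_⟩
      obtain ⟨h1, e10, e11, e14, e15⟩ := h.eval_loadEdge hk hs
      have e9 : (loadEdge.eval s).reg 9 = w := by rw [eval_reg (by decide), h9]
      have e20 : (loadEdge.eval s).reg 20 = s.reg 20 := by rw [eval_reg (by decide)]
      rw [h20] at e20
      rw [eval_seq]
      generalize loadEdge.eval s = s at *
      clear h h9 h20 hs
      obtain ⟨h2, e26⟩ := h1.eval_getCnt (t := 26) e10 (by decide)
      obtain ⟨h3, e27⟩ := h2.eval_getCnt (t := 27) (a := 11) (v := l[k].2)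
        (by rw [eval_reg (by decide), e11]) (by decide)
      have hfr : ∀ a ∈ [9, 14, 15, 20], ((getCnt 27 11).eval ((getCnt 26 10).eval s)).reg a
          = s.reg a := fun a ha => by
        rw [eval_reg (by revert a; decide), eval_reg (by revert a; decide)]
      simp only [List.mem_cons, List.not_mem_nil, or_false, forall_eq_or_imp, forall_eq] at hfr
      obtain ⟨f9, f14, f15, f20⟩ := hfr
      have f26 : ((getCnt 27 11).eval ((getCnt 26 10).eval s)).reg 26 =
          crossCount l lab w l[k].1 := by rw [eval_reg (by decide), e26]
      rw [e9] at f9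
      rw [e14] at f14
      rw [e15] at f15
      rw [e20] at f20
      rw [eval_seq, eval_seq]
      generalize (getCnt 27 11).eval ((getCnt 26 10).eval s) = s at *
      clear h1 h2 e9 e10 e11 e14 e15 e20 e26
      have hmem : ∀ z, z ∈ boundary l lab w ↔ lab z ≠ w ∧ crossCount l lab w z ≠ 0 := by
        simp [boundary]
      rw [List.take_succ_eq_append_getElem hk, List.countP_append, List.countP_singleton]
      refine ifEq_induction (Q := fun s => Holds l s lab (crossCount l lab w) best ∧ s.reg 20 = _)
        (by decide) (by decide) (fun c x y => ?_) fun c x y => ?_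
      · rw [f14, f9] at c
        exact ⟨h3.setReg_ifEq x y, by simp [eval_skip, hmem, c, f20]⟩
      rw [f14, f9] at c
      refine ifEq_induction (Q := fun s => Holds l s lab (crossCount l lab w) best ∧ s.reg 20 = _)
        (by decide) (by decide) (fun c2 x' y' => ?_) fun c2 x' y' => ?_
      · simp only [Config.reg_setReg, f15, f9, reduceIte, Nat.reduceEqDiff] at c2
        exact ⟨(h3.setReg_ifEq x y).setReg_ifEq x' y', by simp [eval_skip, hmem, c2, f20]⟩
      simp only [Config.reg_setReg, f15, f9, reduceIte, Nat.reduceEqDiff] at c2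
      have h4 := (h3.setReg_ifEq x y).setReg_ifEq x' y'
      rw [eval_ite, eval_ite, eval_add, eval_skip]
      simp only [Config.reg_setReg, reduceIte, Nat.reduceEqDiff, f26, e27]
      by_cases c3 : crossCount l lab w l[k].1 = 0
      · rw [if_pos c3]
        exact ⟨h4, by simp [hmem, c3, f20]⟩
      by_cases c4 : crossCount l lab w l[k].2 = 0
      · rw [if_neg c3, if_pos c4]
        exact ⟨h4, by simp [hmem, c4, f20]⟩
      · rw [if_neg c3, if_neg c4]
        exact ⟨h4.setReg (by decide) _, by simp [hmem, c, c2, c3, c4, f20, h3.reg2]⟩)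
  rw [List.take_length] at key
  exact key.2

/-- Two facts are carried along: a new value is always the complement size of a block, hence
attained, and no block is missed. -/
theorem Holds.eval_checkCode (hl : IsEdgeList G l) (h : Holds l s lab cnt best) {w : ℕ}
    (hw : s.reg 9 = w) :
    ∃ best', Holds l (checkCode.eval s) lab (crossCount l lab w) best' ∧ best ≤ best' ∧
      (best' = best ∨ IsBlock G {z | lab z = w} ∧ best' = ({z | lab z = w}ᶜ : Set (Fin n)).ncard) ∧
      (IsBlock G {z | lab z = w} → ({z | lab z = w}ᶜ : Set (Fin n)).ncard ≤ best') := by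
  have h1 := h.eval_crossCode hl hw
  have e9 : (crossCode.eval s).reg 9 = w := by rw [eval_reg (by decide), hw]
  rw [checkCode, eval_seq]
  generalize crossCode.eval s = s at *
  rw [eval_seq, eval_seq, eval_seq, eval_seq, eval_seq]
  simp only [eval_const]
  have h2 := ((((h1.setReg (a := 16) (by decide) 0).setReg (a := 17) (by decide) 0).setReg (a := 18)
    (by decide) 0).setReg (a := 19) (by decide) 0).setReg (a := 20) (by decide) 0
  obtain ⟨h3, hst⟩ := h2.eval_statCode (w := w) (by simpa using e9) (by simp) (by simp) (by simp)
    (by simp)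
  have e20 := eval_reg (p := statCode) (a := 20) (by decide)
    (((((s.setReg 16 0).setReg 17 0).setReg 18 0).setReg 19 0).setReg 20 0)
  rw [eval_seq, eval_seq]
  rw [Config.reg_setReg, if_pos rfl] at e20
  generalize statCode.eval (((((s.setReg 16 0).setReg 17 0).setReg 18 0).setReg 19 0).setReg 20 0)
    = s at *
  obtain ⟨h4, f20⟩ := h3.eval_pairCode hst.label e20
  have hst' : Stats (pairCode.eval s) lab (crossCount l lab w) w n :=
    hst.congr fun a ha => by rw [eval_reg (by revert a; decide)]
  generalize pairCode.eval s = s at *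
  clear h1 h2 h3 e9 e20 hst h
  have hsize : s.reg 16 = ({z | lab z = w} : Set (Fin n)).ncard := by
    rw [hst'.size, Set.ncard_eq_toFinset_card']
    simp [prefixCard]
  have hcompl := Set.ncard_add_ncard_compl {z | lab z = w}
  rw [Nat.card_eq_fintype_card, Fintype.card_fin, ← hsize] at hcompl
  have hne : s.reg 16 ≠ 0 ↔ ∃ z, lab z = w := by
    rw [hsize, Ne, Set.ncard_eq_zero, ← Ne, ← Set.nonempty_iff_ne_empty]
    rfl
  have hnb : s.reg 18 = (boundary l lab w).card := by
    rw [hst'.nbrs]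
    simp [prefixCard, boundary]
  have hblock : IsBlock G {z | lab z = w} ↔ s.reg 16 ≠ 0 ∧ s.reg 17 = 0 ∧ s.reg 19 = s.reg 20 := by
    rw [hl.isBlock_iff, hne, hst'.bad, hst'.pairs, f20, hnb]
    simp only [Fin.is_lt, forall_const]
    rw [eq_comm (a := List.countP _ _)]
  set N := ({z | lab z = w}ᶜ : Set (Fin n)).ncard
  refine ifEq_induction (Q := fun s => ∃ best', Holds l s lab (crossCount l lab w) best' ∧
    best ≤ best' ∧ (best' = best ∨ IsBlock G {z | lab z = w} ∧ best' = N) ∧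
    (IsBlock G {z | lab z = w} → N ≤ best'))
        (by decide) (by decide) (fun c x y => ?_) fun c x y => ?_
  swap
  · exact ⟨best, h4.setReg_ifEq x y, le_rfl, .inl rfl, fun h => absurd (hblock.1 h).2.2 c⟩
  have h5 := h4.setReg_ifEq x y
  rw [eval_ite, eval_ite, eval_skip]
  simp only [Config.reg_setReg, reduceIte, Nat.reduceEqDiff]
  split_ifs with c1 c2
  · exact ⟨best, h5, le_rfl, .inl rfl, fun h => absurd c2 (hblock.1 h).1⟩
  · have hb := hblock.2 ⟨c2, c1, c⟩
    have hN : s.reg 0 - s.reg 16 = N := by rw [h4.reg0]; omega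
    rw [eval_seq, eval_seq, eval_sub, eval_sub, eval_ite, eval_skip, Code.eval]
    simp only [Config.reg_setReg, reduceIte, Nat.reduceEqDiff, hN, h4.reg21]
    have h6 := (h5.setReg (a := 26) (by decide) N).setReg (a := 27) (by decide) (N - best)
    split_ifs with c3
    · exact ⟨best, h6, le_rfl, .inl rfl, fun _ => by omega⟩
    · exact ⟨N, h6.setBest N, by omega, .inr ⟨hb, rfl⟩, fun _ => le_rfl⟩
  · exact ⟨best, h5, le_rfl, .inl rfl, fun h => absurd (hblock.1 h).2.1 c1⟩

theorem Holds.eval_processCode (hl : IsEdgeList G l) (h : Holds l s lab cnt best) {X : Set (Fin n)}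
    (hX : IsLabelling G X [] lab) (hbest : best ∈ properTConvexSizes G) :
    ∃ lab' cnt' best', Holds l (processCode.eval s) lab' cnt' best' ∧
      best' ∈ properTConvexSizes G ∧ best ≤ best' ∧
      ∀ x ∉ X, IsBlock G {y | RIn G Xᶜ x y} → ({y | RIn G Xᶜ x y}ᶜ : Set (Fin n)).ncard ≤ best' := by
  obtain ⟨lab', h1, hlab⟩ := h.eval_mergeCode hl hX
  obtain ⟨cnt', best', h2, h3, h4, h5⟩ := eval_for (b := 0) (i := 9) (p := checkCode)
    (s := mergeCode.eval s)
    (fun k s => ∃ cnt' best', Holds l s lab' cnt' best' ∧ best' ∈ properTConvexSizes G ∧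
      best ≤ best' ∧ ∀ w < k, IsBlock G {z | lab' z = w} →
        ({z | lab' z = w}ᶜ : Set (Fin n)).ncard ≤ best') (by decide) h1.reg0
    ⟨cnt, best, h1, hbest, le_rfl, by simp⟩
    (fun k s x ⟨cnt', best', h1, h2⟩ => ⟨⟨cnt', best', h1.setReg (by decide) x, h2⟩,
      ⟨cnt', best', h1.setReg (by decide) x, h2⟩⟩)
    (fun k hk s ⟨cnt', best', h1, h2, h3, h4⟩ hs => by
      obtain ⟨best'', g1, g2, g3, g4⟩ := h1.eval_checkCode hl hs
      refine ⟨_, best'', g1, ?_, h3.trans g2, fun w hw hb => ?_⟩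
      · rcases g3 with rfl | ⟨hb, rfl⟩
        exacts [h2, hb.ncard_compl_mem]
      · rcases Nat.lt_succ_iff_lt_or_eq.1 hw with hw | rfl
        exacts [(h4 w hw hb).trans g2, g4 hb])
  refine ⟨lab', cnt', best', h2, h3, h4, fun x hx hb => ?_⟩
  -- The component of `x` is the class of its label, which is less than `n` and so was reached by
  -- the loop.
  rw [hlab.setOf_rIn hl hx] at hb ⊢
  exact h5 _ ((hlab.lt_iff x).2 hx) hb

theorem Holds.eval_vertexCode (h : Holds l s lab cnt best) {q : Fin n} (hq : s.reg 6 = q) :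
    ∃ lab', Holds l (vertexCode.eval s) lab' cnt best ∧ IsLabelling G {q} [] lab' := by
  have h1 := h.forLab (fun v => v) (p := setLab 8 8) (fun s => s.reg 6 = q) hq
    (fun s x h => by simpa using h) (fun z s lab' h1 h2 hz _ =>
      ⟨by rw [eval_reg (by decide), h1], h2.eval_setLab hz hz (by decide)⟩)
  refine ⟨_, h1.2.eval_setLab h1.1 h1.2.reg0 (by decide), isLabelling_nil ?_ ?_⟩
  · simp
  · intro v hv
    exact Function.update_of_ne hv _ _

/-- With label `0` on `u` and `v` only, the crossing edges at another vertex are those to `u` or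
`v`. The counting routine can thus be reused to find common neighbours. -/
theorem two_le_crossCount_iff (hl : IsEdgeList G l) {u v z : Fin n} (huv : u ≠ v) (hu : z ≠ u)
    (hv : z ≠ v) :
    2 ≤ crossCount l (fun x => if x = u ∨ x = v then 0 else 1) 0 z ↔ G.Adj z u ∧ G.Adj z v := by
  rw [crossCount]
  have hmem : ∀ x, x ∈ (Finset.univ.filter fun x => ListAdj l z x ∧
      ¬ ((if z = u ∨ z = v then 0 else 1) = 0 ↔ (if x = u ∨ x = v then 0 else 1) = 0)) ↔
      G.Adj z x ∧ (x = u ∨ x = v) := by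
    intro x
    simp only [Finset.mem_filter, Finset.mem_univ, true_and, hl.listAdj_iff, hu, hv, or_false,
      if_false]
    by_cases hx : x = u ∨ x = v <;> simp [hx]
  change 1 < _ ↔ _
  rw [Finset.one_lt_card]
  constructor
  · rintro ⟨a, ha, b, hb, hab⟩
    obtain ⟨ha, ha'⟩ := (hmem a).1 ha
    obtain ⟨hb, hb'⟩ := (hmem b).1 hb
    rcases ha' with rfl | rfl <;> rcases hb' with rfl | rfl <;> tauto
  · rintro ⟨h1, h2⟩
    exact ⟨u, (hmem u).2 ⟨h1, .inl rfl⟩, v, (hmem v).2 ⟨h2, .inr rfl⟩, huv⟩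

theorem Holds.eval_nbrsCode (hl : IsEdgeList G l) (h : Holds l s lab cnt best) {k : ℕ}
    (hk : k < l.length) (hs : s.reg 6 = k) :
    ∃ lab' cnt', Holds l (nbrsCode.eval s) lab' cnt' best ∧
      IsLabelling G (commonNbrs G l[k].1 l[k].2) [] lab' := by
  obtain ⟨h1, e12, e13⟩ := h.eval_edge hk hs (x := 12) (y := 13) (by decide) (by decide) (by decide)
  have huv := (hl.adj_getElem hk).ne
  rw [nbrsCode, eval_seq]
  generalize (edge 6 12 13).eval s = s at *
  generalize l[k].1 = u at *
  generalize l[k].2 = v at *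
  rw [eval_seq, eval_const, eval_seq]
  obtain ⟨⟨f12, f13, f9⟩, h2⟩ := (h1.setReg (a := 9) (by decide) 0).forLab (fun _ => 1)
    (p := setLab 8 2) (fun s => s.reg 12 = u ∧ s.reg 13 = v ∧ s.reg 9 = 0)
    (by simp [e12, e13]) (fun s x h => by simpa using h) (fun z s lab' h1 h2 hz _ =>
      ⟨by rwa [eval_reg (by decide), eval_reg (by decide), eval_reg (by decide)],
        h2.eval_setLab hz h2.reg2 (by decide)⟩)
  generalize (Code.loop 0 8 (setLab 8 2)).eval _ = s at *
  have h3 := (h2.eval_setLab f12 f9 (by decide)).eval_setLab (a := 13) (r := 9) (v := v) (x := 0)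
    (by rw [eval_reg (by decide), f13]) (by rw [eval_reg (by decide), f9]) (by decide)
  have g9 : ((setLab 13 9).eval ((setLab 12 9).eval s)).reg 9 = 0 := by
    rw [eval_reg (by decide), eval_reg (by decide), f9]
  rw [show Function.update (Function.update (fun _ : Fin n => 1) u 0) v 0 =
    fun x => if x = u ∨ x = v then 0 else 1 by
      funext x
      simp only [Function.update_apply]
      by_cases hxu : x = u <;> by_cases hxv : x = v <;> simp [hxu, hxv]] at h3
  rw [eval_seq, eval_seq]
  generalize (setLab 13 9).eval ((setLab 12 9).eval s) = s at *
  have h4 := h3.eval_crossCode hl g9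
  rw [eval_seq]
  generalize crossCode.eval s = s at *
  set lab0 : Fin n → ℕ := fun x => if x = u ∨ x = v then 0 else 1 with hlab0
  -- Vertices of the common closed neighbourhood receive the label `n`, all others their own index.
  have h5 := h4.forLab (fun z => if lab0 z = 0 ∨ 2 ≤ crossCount l lab0 0 z then n else z)
    (p := getLab 14 8 ;; getCnt 23 8 ;; sub 27 23 2 ;;
      ite 14 (ite 27 (setLab 8 0) (setLab 8 8)) (setLab 8 0)) (fun _ => True) trivial
    (fun _ _ _ => ⟨trivial, trivial⟩) (fun z s lab' _ h hz hlz => by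
      refine ⟨trivial, ?_⟩
      rw [eval_seq, eval_seq, eval_seq, eval_sub]
      obtain ⟨h1, e14⟩ := h.eval_getLab (t := 14) hz (by decide)
      obtain ⟨h2, e23⟩ := h1.eval_getCnt (t := 23) (a := 8) (v := z)
        (by rw [eval_reg (by decide), hz]) (by decide)
      have e14' : ((getCnt 23 8).eval ((getLab 14 8).eval s)).reg 14 = lab0 z := by
        rw [eval_reg (by decide), e14, hlz]
      have e8 : ((getCnt 23 8).eval ((getLab 14 8).eval s)).reg 8 = z := by
        rw [eval_reg (by decide), eval_reg (by decide), hz]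
      generalize (getCnt 23 8).eval ((getLab 14 8).eval s) = s at *
      have h3 := h2.setReg (a := 27) (by decide) (s.reg 23 - s.reg 2)
      rw [eval_ite, eval_ite]
      have e27 : (s.setReg 27 (s.reg 23 - s.reg 2)).reg 27 = crossCount l lab0 0 z - 1 := by
        simp [e23, h2.reg2]
      have f14 : (s.setReg 27 (s.reg 23 - s.reg 2)).reg 14 = lab0 z := by simpa using e14'
      have f8 : (s.setReg 27 (s.reg 23 - s.reg 2)).reg 8 = z := by simpa using e8
      rw [e27, f14]
      by_cases c1 : lab0 z = 0
      · rw [if_pos c1, if_pos (.inl c1)]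
        exact h3.eval_setLab f8 h3.reg0 (by decide)
      rw [if_neg c1]
      by_cases c2 : 2 ≤ crossCount l lab0 0 z
      · rw [if_neg (by omega), if_pos (.inr c2)]
        exact h3.eval_setLab f8 h3.reg0 (by decide)
      · rw [if_pos (by omega), if_neg (by tauto)]
        exact h3.eval_setLab f8 f8 (by decide))
  have hX : ∀ z, (lab0 z = 0 ∨ 2 ≤ crossCount l lab0 0 z) ↔ z ∈ commonNbrs G u v := by
    intro z
    simp only [commonNbrs, Set.mem_ofPred_eq]
    by_cases hzu : z = u
    · simp [hlab0, hzu]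
    by_cases hzv : z = v
    · simp [hlab0, hzv]
    rw [two_le_crossCount_iff hl huv hzu hzv]
    simp [hlab0, hzu, hzv]
  refine ⟨_, _, h5.2, isLabelling_nil (fun z hz => ?_) fun z hz => ?_⟩
  · rw [if_pos ((hX z).2 hz)]
  · rw [if_neg fun h => hz ((hX z).1 h)]

/-- `best` is at least as large as the complement of every block among the components of `G - X`. -/
def Covers (G : SimpleGraph (Fin n)) (X : Set (Fin n)) (best : ℕ) : Prop :=
  ∀ x ∉ X, IsBlock G {y | RIn G Xᶜ x y} → ({y | RIn G Xᶜ x y}ᶜ : Set (Fin n)).ncard ≤ best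

theorem Holds.eval_vertices (hl : IsEdgeList G l) (h : Holds l s lab cnt best)
    (hbest : best ∈ properTConvexSizes G) :
    ∃ lab' cnt' best', Holds l ((Code.loop 0 6 (vertexCode ;; processCode)).eval s) lab' cnt' best' ∧
      best' ∈ properTConvexSizes G ∧ ∀ q : Fin n, Covers G {q} best' := by
  obtain ⟨lab', cnt', best', h1, h2, h3⟩ := eval_for (b := 0) (i := 6)
    (p := vertexCode ;; processCode) (s := s)
    (fun k s => ∃ lab' cnt' best', Holds l s lab' cnt' best' ∧ best' ∈ properTConvexSizes G ∧
      ∀ q : Fin n, q.val < k → Covers G {q} best') (by decide) h.reg0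
    ⟨lab, cnt, best, h, hbest, by simp⟩
    (fun k s x ⟨lab', cnt', best', h1, h2⟩ => ⟨⟨lab', cnt', best', h1.setReg (by decide) x, h2⟩,
      ⟨lab', cnt', best', h1.setReg (by decide) x, h2⟩⟩)
    (fun k hk s ⟨lab', cnt', best', h1, h2, h3⟩ hs => by
      obtain ⟨lab'', h4, h5⟩ := h1.eval_vertexCode (G := G) (q := ⟨k, hk⟩) hs
      obtain ⟨lab₃, cnt₃, best₃, h6, h7, h8, h9⟩ := h4.eval_processCode hl h5 h2
      refine ⟨lab₃, cnt₃, best₃, h6, h7, fun q hq => ?_⟩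
      rcases Nat.lt_succ_iff_lt_or_eq.1 hq with hq | rfl
      · exact fun x hx hb => (h3 q hq x hx hb).trans h8
      · exact h9)
  exact ⟨lab', cnt', best', h1, h2, fun q => h3 q q.2⟩

theorem Holds.eval_edges (hl : IsEdgeList G l) (h : Holds l s lab cnt best)
    (hbest : best ∈ properTConvexSizes G) :
    ∃ lab' cnt' best', Holds l ((Code.loop 1 6 (nbrsCode ;; processCode)).eval s) lab' cnt' best' ∧
      best' ∈ properTConvexSizes G ∧ best ≤ best' ∧
      ∀ e ∈ l, Covers G (commonNbrs G e.1 e.2) best' := by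
  have key := eval_for (b := 1) (i := 6)
    (p := nbrsCode ;; processCode) (s := s)
    (fun k s => ∃ lab' cnt' best', Holds l s lab' cnt' best' ∧ best' ∈ properTConvexSizes G ∧
      best ≤ best' ∧ ∀ e ∈ l.take k, Covers G (commonNbrs G e.1 e.2) best') (by decide) h.reg1
    ⟨lab, cnt, best, h, hbest, le_rfl, by simp⟩
    (fun k s x ⟨lab', cnt', best', h1, h2⟩ => ⟨⟨lab', cnt', best', h1.setReg (by decide) x, h2⟩,
      ⟨lab', cnt', best', h1.setReg (by decide) x, h2⟩⟩)
    (fun k hk s ⟨lab', cnt', best', h1, h2, h2', h3⟩ hs => by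
      obtain ⟨lab'', cnt'', h4, h5⟩ := h1.eval_nbrsCode hl hk hs
      obtain ⟨lab₃, cnt₃, best₃, h6, h7, h8, h9⟩ := h4.eval_processCode hl h5 h2
      refine ⟨lab₃, cnt₃, best₃, h6, h7, h2'.trans h8, fun e he => ?_⟩
      rw [List.take_succ_eq_append_getElem hk, List.mem_append, List.mem_singleton] at he
      rcases he with he | rfl
      · exact fun x hx hb => (h3 e he x hx hb).trans h8
      · exact h9)
  rwa [List.take_length] at key

/-- Every nonempty proper convex set is contained in the complement of a block that was covered; the
empty set has size `0`. -/
theorem eq_tConvexityNumber (hl : IsEdgeList G l) (hG : G.Connected)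
    (hbest : best ∈ properTConvexSizes G) (h1 : ∀ q : Fin n, Covers G {q} best)
    (h2 : ∀ e ∈ l, Covers G (commonNbrs G e.1 e.2) best) : best = tConvexityNumber G := by
  have := hG.nonempty
  refine IsGreatest.unique ⟨hbest, ?_⟩ (isGreatest_tConvexityNumber G)
  rintro _ ⟨S, hS, hne, rfl⟩
  rcases hS.exists_isBlock hG.preconnected hne with rfl | ⟨X, x, hx, hX, hb, hsub⟩
  · simp
  · refine (Set.ncard_le_ncard hsub).trans ?_
    suffices h : Covers G X best from h x hx hb
    rcases hX with ⟨q, rfl⟩ | ⟨u, v, huv, rfl⟩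
    · exact h1 q
    · rcases hl.listAdj_iff.2 huv with hm | hm
      · exact h2 _ hm
      -- The edge may be listed in the opposite orientation.
      · rw [commonNbrs_comm]
        exact h2 _ hm

theorem inputConfig_mem (l : List (Fin n × Fin n)) {k : ℕ} (hk : k < l.length) :
    (inputConfig n l).mem (k + k) = l[k].1 ∧ (inputConfig n l).mem (k + k + 1) = l[k].2 := by
  simp only [inputConfig]
  induction l generalizing k with
  | nil => simp at hk
  | cons e l ih =>
    cases k with
    | zero => simp
    | succ k =>
      rw [show k + 1 + (k + 1) = k + k + 1 + 1 by omega]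
      simpa using ih (by simpa using hk)

theorem eval_mainCode (hl : IsEdgeList G l) (hG : G.Connected) :
    (mainCode.eval ((inputConfig n l).setReg 2 1)).reg 21 = tConvexityNumber G := by
  set s := (inputConfig n l).setReg 2 1
  rw [mainCode, eval_seq, eval_seq, eval_seq, eval_seq, eval_add, eval_add, eval_const]
  have h0 : Holds l (((s.setReg 4 (s.reg 1 + s.reg 1)).setReg 5
      ((s.setReg 4 (s.reg 1 + s.reg 1)).reg 4 + (s.setReg 4 (s.reg 1 + s.reg 1)).reg 0)).setReg 21 0)
      (fun v => s.mem (2 * l.length + v)) (fun v => s.mem (2 * l.length + n + v)) 0 := by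
    refine ⟨?_, ?_, ?_, ?_, ?_, ?_, fun k hk => (inputConfig_mem l hk).1,
      fun k hk => (inputConfig_mem l hk).2, fun v => rfl, fun v => rfl⟩ <;>
      simp [s, inputConfig, two_mul]
  have := hG.nonempty
  -- The initial value `0` is attained by the empty set, so the stored value is the size of a proper
  -- convex set from the start.
  obtain ⟨lab, cnt, best, h1, h2, h3⟩ := h0.eval_vertices hl
    ⟨∅, tConvex_empty, Set.empty_ne_univ, Set.ncard_empty _⟩
  obtain ⟨lab', cnt', best', h4, h5, h6, h7⟩ := h1.eval_edges hl h2
  rw [h4.reg21]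
  exact eq_tConvexityNumber hl hG h5 (fun q x hx hb => (h3 q x hx hb).trans h6) h7

theorem runs_tConvexityProg (hl : IsEdgeList G l) (hG : G.Connected) :
    ∃ (s : Config) (t : ℕ), Runs tConvexityProg (inputConfig n l) s t ∧
      s.reg 0 = tConvexityNumber G ∧ t ≤ 10000 * (n * G.edgeSet.ncard ^ 2 + 1) := by
  obtain ⟨t, ht, hr⟩ := runs_compile mainCode_regular mainCode_writes
    ((inputConfig n l).setReg 2 1) (by simp)
  -- Connectedness enters the time bound here.
  have hcard := hG.card_vert_le_card_edgeSet_add_one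
  rw [Nat.card_eq_fintype_card, Fintype.card_fin, Nat.card_coe_set_eq] at hcard
  have hn : 0 < n := Fin.pos_iff_nonempty.2 hG.nonempty
  rw [show ((inputConfig n l).setReg 2 1).reg 0 = n by simp [inputConfig],
    show ((inputConfig n l).setReg 2 1).reg 1 = G.edgeSet.ncard by
      simp [inputConfig, hl.length_eq]] at ht
  refine ⟨_, _, .seq (.const _ 2 1) (.seq hr (.copy _ 0 21)), ?_, ?_⟩
  · simpa using eval_mainCode hl hG
  · have := bound_mainCode hn hcard
    omega

end Spec
end TrianglePath

theorem mainTheorem1 :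
    (∀ (V : Type*) [Finite V] (G : SimpleGraph V), G.Connected →
      IsGreatest (TrianglePath.properTConvexSizes G) (TrianglePath.tConvexityNumber G) ∧
      IsGreatest (TrianglePath.extendSizes G) (TrianglePath.cNumber G) ∧
      TrianglePath.tConvexityNumber G = TrianglePath.cNumber G) ∧
    (∃ (P : TrianglePath.Prog) (K : ℕ),
      ∀ (n : ℕ) (G : SimpleGraph (Fin n)) (l : List (Fin n × Fin n)),
        G.Connected → TrianglePath.IsEdgeList G l →
          ∃ (s : TrianglePath.Config) (t : ℕ),
            TrianglePath.Runs P (TrianglePath.inputConfig n l) s t ∧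
            s.reg 0 = TrianglePath.tConvexityNumber G ∧
            t ≤ K * (n * G.edgeSet.ncard ^ 2 + 1)) := by
  refine ⟨fun V _ G hG => ?_, TrianglePath.tConvexityProg, 10000, fun n G l hG hl =>
    TrianglePath.runs_tConvexityProg hl hG⟩
  have := hG.nonempty
  exact ⟨TrianglePath.isGreatest_tConvexityNumber G, TrianglePath.isGreatest_cNumber G,
    TrianglePath.tConvexityNumber_eq_cNumber G⟩
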